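/- Fix a field $\mathbb{F}$. A finite filtered space is a pair $\mathbf X=(X,F_X)$ of a finite set $X$ and a function $F_X:\mathrm{pow}(X)\to\mathbb{R}$ with $F_X(\tau)\le F_X(\sigma)$ whenever $\tau\subseteq\sigma$. For $\varepsilon\in\mathbb{R}$ let $L_\varepsilon(\mathbf X)$ be the simplicial complex whose simplices are the non-empty $\sigma\subseteq X$ with $F_X(\sigma)\le\varepsilon$. For $k\in\mathbb{N}$ let $\mathbb{V}_k(\mathbf X)$ be the persistence vector space formed by the simplicial homology spaces $H_k(L_\varepsilon(\mathbf X);\mathbb{F})$, $\varepsilon\in\mathbb{R}$, and the maps induced by the inclusions $L_\varepsilon(\mathbf X)\subseteq L_{\varepsilon'}(\mathbf X)$, $\varepsilon\le\varepsilon'$. Its degree-$k$ persistence diagram $\mathrm{D}_k(\mathbf X)$ is the finite multiset of points $(b,d)$, $b\in\mathbb{R}$, $d\in\mathbb{R}\cup\{+\infty\}$, $b<d$, such that $\mathbb{V}_k(\mathbf X)$ is isomorphic to the direct sum of the interval persistence vector spaces on the intervals $[b,d)$. For finite diagrams $D_1=\{P_\alpha\}_{\alpha\in A_1}$ and $D_2=\{Q_\alpha\}_{\alpha\in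 A_2}$ let $$d_{\mathcal D}(D_1,D_2)=\min_{(B_1,B_2,\varphi)}\max\Big(\max_{\beta\in B_1}\|P_\beta-Q_{\varphi(\beta)}\|_\infty,\ \max_{\alpha\in A_1\setminus B_1}\tfrac12\mathrm{pers}(P_\alpha),\ \max_{\alpha\in A_2\setminus B_2}\tfrac12\mathrm{pers}(Q_\alpha)\Big)\in[0,\infty],$$ over all $B_1\subseteq A_1$, $B_2\subseteq A_2$ and bijections $\varphi:B_1\to B_2$. Here $\mathrm{pers}(b,d)=d-b$, two coordinates equal to $+\infty$ have difference $0$, and a coordinate $+\infty$ has infinite distance to a real one; the maximum of the empty set is $0$. For finite filtered spaces $\mathbf X=(X,F_X)$ and $\mathbf Y=(Y,F_Y)$ let $$d_{\mathcal F}(\mathbf X,\mathbf Y)=\inf\Big\{\max_{\tau\in\mathrm{pow}(Z)}\big|F_X(\varphi_X(\tau))-F_Y(\varphi_Y(\tau))\big|\Big\}\in[0,\infty],$$ the infimum being over all finite sets $Z$ and all surjections $\varphi_X:Z\to X$ and $\varphi_Y:Z\to Y$ (and $\inf\emptyset=\infty$). Theorem. For all finite filtered spaces $\mathbf X$ and $\mathbf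 Y$, possibly on different underlying sets, and all $k\in\mathbb{N}$, the persistence diagrams $\mathrm{D}_k(\mathbf X)$ and $\mathrm{D}_k(\mathbf Y)$ exist and are unique, and $$d_{\mathcal D}\big(\mathrm{D}_k(\mathbf X),\mathrm{D}_k(\mathbf Y)\big)\le d_{\mathcal F}(\mathbf X,\mathbf Y).$$ -/

import Mathlib

set_option maxSynthPendingDepth 3

open scoped ENNReal

noncomputable section

namespace FilteredSpaces

universe u v w

/-! ### Simplicial homology with coefficients in a field -/

section Homology

variable (𝕜 : Type u) [Field 𝕜] {X : Type v}

/-- The vertices `x 0, …, x n` (repetitions allowed) span a simplex of `K`. -/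
def Spans (K : PreAbstractSimplicialComplex X) {n : ℕ} (x : Fin (n + 1) → X) : Prop :=
  (Set.finite_range x).toFinset ∈ K.faces

/-- Formal `𝕜`-linear combinations of `(n + 1)`-tuples of vertices. -/
abbrev Tuples (X : Type v) (n : ℕ) : Type (max u v) := (Fin (n + 1) → X) →₀ 𝕜

/-- The ordered simplicial `n`-chains of `K`: combinations of tuples spanning a simplex of `K`. -/
def chains (K : PreAbstractSimplicialComplex X) (n : ℕ) : Submodule 𝕜 (Tuples 𝕜 X n) :=
  Finsupp.supported 𝕜 𝕜 {x | Spans K x}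

/-- `∂ (x₀, …, xₙ₊₁) = ∑ᵢ (-1)ⁱ (x₀, …, x̂ᵢ, …, xₙ₊₁)`. -/
def boundary (X : Type v) (n : ℕ) : Tuples 𝕜 X (n + 1) →ₗ[𝕜] Tuples 𝕜 X n :=
  Finsupp.linearCombination 𝕜 fun x =>
    ∑ i : Fin (n + 2), Finsupp.single (x ∘ i.succAbove) ((-1 : 𝕜) ^ (i : ℕ))

/-- The `n`-cycles of `K`; in degree `0` all chains are cycles (homology is not reduced). -/
def cycles (K : PreAbstractSimplicialComplex X) : (n : ℕ) → Submodule 𝕜 (Tuples 𝕜 X n)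
  | 0 => chains 𝕜 K 0
  | n + 1 => chains 𝕜 K (n + 1) ⊓ LinearMap.ker (boundary 𝕜 X n)

/-- The `n`-boundaries of `K`. -/
def boundaries (K : PreAbstractSimplicialComplex X) (n : ℕ) : Submodule 𝕜 (Tuples 𝕜 X n) :=
  (chains 𝕜 K (n + 1)).map (boundary 𝕜 X n)

/-- The simplicial homology `Hₙ(K; 𝕜)`, cycles modulo boundaries. -/
abbrev Homology (K : PreAbstractSimplicialComplex X) (n : ℕ) : Type (max u v) :=
  cycles 𝕜 K n ⧸ (boundaries 𝕜 K n).submoduleOf (cycles 𝕜 K n)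

theorem chains_mono {K L : PreAbstractSimplicialComplex X} (h : K ≤ L) (n : ℕ) :
    chains 𝕜 K n ≤ chains 𝕜 L n :=
  Finsupp.supported_mono fun _ hx => h hx

theorem cycles_mono {K L : PreAbstractSimplicialComplex X} (h : K ≤ L) (n : ℕ) :
    cycles 𝕜 K n ≤ cycles 𝕜 L n := by
  cases n with
  | zero => exact chains_mono 𝕜 h 0
  | succ n => exact inf_le_inf_right _ (chains_mono 𝕜 h (n + 1))

theorem boundaries_mono {K L : PreAbstractSimplicialComplex X} (h : K ≤ L) (n : ℕ) :
    boundaries 𝕜 K n ≤ boundaries 𝕜 L n :=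
  Submodule.map_mono (chains_mono 𝕜 h (n + 1))

/-- The map `Hₙ(K; 𝕜) → Hₙ(L; 𝕜)` induced by the inclusion of a subcomplex `K ≤ L`. -/
def homologyMap {K L : PreAbstractSimplicialComplex X} (h : K ≤ L) (n : ℕ) :
    Homology 𝕜 K n →ₗ[𝕜] Homology 𝕜 L n :=
  Submodule.mapQ _ _ (Submodule.inclusion (cycles_mono 𝕜 h n))
    fun _ hc => boundaries_mono 𝕜 h n hc

end Homology

/-! ### Persistence vector spaces and their barcodes -/

/-- A persistence vector space indexed by the real line. -/
structure PersistenceSpace (𝕜 : Type u) [Field 𝕜] where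
  V : ℝ → Type w
  [addCommGroup : ∀ a, AddCommGroup (V a)]
  [module : ∀ a, Module 𝕜 (V a)]
  map : ∀ {a b : ℝ}, a ≤ b → V a →ₗ[𝕜] V b
  map_refl : ∀ (a : ℝ) (x : V a), map (le_refl a) x = x
  map_trans : ∀ {a b c : ℝ} (hab : a ≤ b) (hbc : b ≤ c) (x : V a),
    map hbc (map hab x) = map (hab.trans hbc) x

attribute [instance] PersistenceSpace.addCommGroup PersistenceSpace.module

/-- Two persistence vector spaces are isomorphic: there are linear isomorphisms in every degree of
the filtration commuting with the structure maps. -/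
def PersistenceSpace.Isomorphic {𝕜 : Type u} [Field 𝕜] (M : PersistenceSpace.{u, v} 𝕜)
    (N : PersistenceSpace.{u, w} 𝕜) : Prop :=
  ∃ e : ∀ a : ℝ, M.V a ≃ₗ[𝕜] N.V a,
    ∀ (a b : ℝ) (h : a ≤ b) (x : M.V a), e b (M.map h x) = N.map h (e a x)

/-- A point `(b, d)` with `b` real and `d` real or `+∞`, standing for the interval `[b, d)`. -/
abbrev Bar : Type := ℝ × WithTop ℝ

/-- A finite persistence diagram: a finite multiset of points. -/
abbrev Diagram : Type := Multiset Bar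

/-- The parameter `a` lies in the interval `[b, d)`. -/
def Bar.Alive (P : Bar) (a : ℝ) : Prop := P.1 ≤ a ∧ (a : WithTop ℝ) < P.2

open Classical in
/-- The direct sum, over the points `(b, d)` of `D` counted with multiplicity, of the interval
persistence vector spaces: `𝕜` on `[b, d)`, zero elsewhere, and identity maps inside `[b, d)`. -/
def intervalSum (𝕜 : Type u) [Field 𝕜] (D : Diagram) : PersistenceSpace.{u, u} 𝕜 where
  V a := {α : D.ToType // Bar.Alive (α : Bar) a} → 𝕜
  map {a _} _ :=
    { toFun := fun f α => if h : Bar.Alive (α.1 : Bar) a then f ⟨α.1, h⟩ else 0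
      map_add' := by
        intro f g
        funext α
        by_cases h : Bar.Alive (α.1 : Bar) a <;> simp [h]
      map_smul' := by
        intro r f
        funext α
        by_cases h : Bar.Alive (α.1 : Bar) a <;> simp [h] }
  map_refl := by
    intro a f
    funext α
    simp [α.2]
  map_trans := by
    intro a b c hab hbc f
    funext α
    by_cases h : Bar.Alive (α.1 : Bar) a
    · have hb : Bar.Alive (α.1 : Bar) b :=
        ⟨h.1.trans hab, lt_of_le_of_lt (WithTop.coe_le_coe.2 hbc) α.2.2⟩
      simp [h, hb]
    · simp [h]

/-- `D` is the multiset of (nonempty) intervals `I(V)` classifying `V` up to isomorphism. -/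
def IsBarcode {𝕜 : Type u} [Field 𝕜] (V : PersistenceSpace.{u, w} 𝕜) (D : Diagram) : Prop :=
  (∀ P ∈ D, (P.1 : WithTop ℝ) < P.2) ∧ V.Isomorphic (intervalSum 𝕜 D)

/-! ### Bottleneck distance -/

/-- Distance of two right endpoints; `+∞` is at distance `0` from itself, `∞` from reals. -/
def deathDist : WithTop ℝ → WithTop ℝ → ℝ≥0∞
  | none, none => 0
  | some x, some y => edist x y
  | _, _ => ∞

/-- The `ℓ^∞` distance of two points of the extended plane. -/
def Bar.dist (P Q : Bar) : ℝ≥0∞ := max (edist P.1 Q.1) (deathDist P.2 Q.2)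

/-- Half of the persistence `d - b` of a point `(b, d)`. -/
def Bar.halfPers : Bar → ℝ≥0∞
  | (_, none) => ∞
  | (b, some d) => ENNReal.ofReal ((d - b) / 2)

/-- The cost `J(φ)` of a bijection `φ` between subsets of the index sets of two diagrams. -/
def matchingCost {D₁ D₂ : Diagram} {B₁ : Set D₁.ToType} {B₂ : Set D₂.ToType} (φ : B₁ ≃ B₂) :
    ℝ≥0∞ :=
  max (⨆ β : B₁, Bar.dist (β.1 : Bar) ((φ β).1 : Bar))
    (max (⨆ α : (B₁ᶜ : Set D₁.ToType), Bar.halfPers (α.1 : Bar))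
      (⨆ α : (B₂ᶜ : Set D₂.ToType), Bar.halfPers (α.1 : Bar)))

/-- The bottleneck distance of two finite persistence diagrams. -/
def bottleneckDist (D₁ D₂ : Diagram) : ℝ≥0∞ :=
  ⨅ (B₁ : Set D₁.ToType) (B₂ : Set D₂.ToType) (φ : B₁ ≃ B₂), matchingCost φ

/-! ### Filtered spaces -/

/-- A filtration over `X`: a monotone real function on the power set. -/
structure Filtration (X : Type v) where
  toFun : Set X → ℝ
  mono : Monotone toFun

namespace Filtration

variable {X : Type v} {Y : Type w}

/-- The simplicial complex `L_ε`, whose simplices are the nonempty `σ ⊆ X` with `F σ ≤ ε`. -/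
def sublevel (F : Filtration X) (ε : ℝ) : PreAbstractSimplicialComplex X where
  faces := {σ | σ.Nonempty ∧ F.toFun (σ : Set X) ≤ ε}
  isRelLowerSet_faces := fun _ hσ =>
    ⟨hσ.1, fun _ hτσ hτ => ⟨hτ, (F.mono (Finset.coe_subset.2 hτσ)).trans hσ.2⟩⟩

theorem sublevel_mono (F : Filtration X) {ε δ : ℝ} (h : ε ≤ δ) : F.sublevel ε ≤ F.sublevel δ :=
  fun _ hσ => ⟨hσ.1, hσ.2.trans h⟩

/-- The persistence vector space given by the degree `k` homology of the complexes `L_ε` and the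
maps induced by inclusions. -/
def persistentHomology (𝕜 : Type u) [Field 𝕜] (F : Filtration X) (k : ℕ) :
    PersistenceSpace.{u, max u v} 𝕜 where
  V ε := Homology 𝕜 (F.sublevel ε) k
  map h := homologyMap 𝕜 (F.sublevel_mono h) k
  map_refl := by
    intro a x
    induction x using Submodule.Quotient.induction_on
    rfl
  map_trans := by
    intro a b c hab hbc x
    induction x using Submodule.Quotient.induction_on
    rfl

/-- `D` is the degree `k` persistence diagram of the filtered space `(X, F)`. -/
def IsPersistenceDiagram (𝕜 : Type u) [Field 𝕜] (F : Filtration X) (k : ℕ) (D : Diagram) : Prop :=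
  IsBarcode (F.persistentHomology 𝕜 k) D

/-- The pullback filtration `τ ↦ F (φ τ)`. -/
def pullback {Z : Type*} (F : Filtration X) (φ : Z → X) : Filtration Z where
  toFun τ := F.toFun (φ '' τ)
  mono _ _ h := F.mono (Set.image_mono h)

/-- The sup norm of the difference of two filtrations over the same set. -/
def supDist {Z : Type*} (F G : Filtration Z) : ℝ≥0∞ :=
  ⨆ τ : Set Z, edist (F.toFun τ) (G.toFun τ)

/-- The distance of two filtered spaces: the infimum over all finite `Z` (up to bijection, all of
them are in `Type`) and all surjections `φX : Z → X` and `φY : Z → Y`. -/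
def filtDist (F : Filtration X) (G : Filtration Y) : ℝ≥0∞ :=
  ⨅ (Z : Type) (_ : Finite Z) (φX : Z → X) (_ : Function.Surjective φX)
    (φY : Z → Y) (_ : Function.Surjective φY), supDist (F.pullback φX) (G.pullback φY)

end Filtration

end FilteredSpaces

end

noncomputable section

namespace FilteredSpaces

universe u v w

/-! Two finite-dimensional facts and a compactness argument give the theorem, without interleavings.

Fix a filtration `H` on a finite set. The cycle spaces of its sublevel complexes form a chain of
subspaces of the finite-dimensional space of tuples, and so do the boundary spaces. Two chains
always have a common adapted basis (`exists_linearIndepOn_span_inter_eq`). Each basis vector that is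
ever a cycle enters the cycles at the value of one set `σ` and the boundaries at the value of one
set `τ`, or never. The bars `[H σ, H τ)` of positive length form the diagram. The pairing `(σ, τ)`
uses only the order that `H` puts on subsets, so it also computes the diagram of every `F` coarser
than `H` (`exists_pairing`). Uniqueness holds because the ranks of the structure maps count the bars
alive at two parameters, and these counts determine the bars.

If `F` is coarser than `G` and they differ by at most `c`, a single pairing serves both, and
matching bars of the same index costs at most `c`. In general, interpolate linearly from `F` to `G`.
Near each time `t` the filtration at `t` is coarser than its neighbours, because finitely many
strict inequalities persist. The local bounds are proportional to elapsed time, so they add up to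
`c` along `[0, 1]` (`matched_of_abs_sub_le`).

For different vertex sets, pull both filtrations back to `Z`. A section of the surjection is a
homotopy inverse by contiguity, so persistent homology is unchanged
(`persistentHomology_pullback_isomorphic`). -/

/-! ### Common adapted bases of two chains of subspaces -/

open Submodule in
/-- Two chains of subspaces of a finite-dimensional space have a common adapted basis. -/
theorem exists_linearIndepOn_span_inter_eq {𝕜 : Type*} {V : Type*} [Field 𝕜] [AddCommGroup V]
    [Module 𝕜 V] [FiniteDimensional 𝕜 V] {𝒜 ℬ : Set (Submodule 𝕜 V)}
    (h𝒜 : IsChain (· ≤ ·) 𝒜) (hℬ : IsChain (· ≤ ·) ℬ) (W : Submodule 𝕜 V) :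
    ∃ s : Set V, LinearIndepOn 𝕜 id s ∧ span 𝕜 s = W ∧
      (∀ A ∈ 𝒜, span 𝕜 (s ∩ A) = W ⊓ A) ∧ ∀ B ∈ ℬ, span 𝕜 (s ∩ B) = W ⊓ B := by
  induction W using WellFoundedLT.induction with
  | ind W ih =>
    by_cases hW : W = ⊥
    · subst hW
      refine ⟨∅, linearIndepOn_empty _ _, by simp, by simp, by simp⟩
    have hbot : ⊥ < W := bot_lt_iff_ne_bot.2 hW
    -- The proper intersections `W ⊓ B` form a chain, so a largest one exists, and any hyperplane of
    -- `W` above it contains them all. Inserting `⊥` covers the case where there are none.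
    obtain ⟨W', hcov, hW'⟩ : ∃ W', W' ⋖ W ∧ ∀ B ∈ ℬ, ¬ W ≤ B → W ⊓ B ≤ W' := by
      let T : Set (Submodule 𝕜 V) := insert ⊥ {M | ∃ B ∈ ℬ, ¬ W ≤ B ∧ M = W ⊓ B}
      obtain ⟨M, hMT, hM⟩ := wellFounded_gt.has_min T ⟨⊥, Set.mem_insert _ _⟩
      have hMW : M < W := by
        rcases hMT with rfl | ⟨B, -, hB, rfl⟩
        · exact hbot
        · exact lt_of_le_of_ne inf_le_left fun h => hB (inf_eq_left.1 h)
      obtain ⟨W', hMW', hcov⟩ := exists_le_covBy_of_lt hMW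
      refine ⟨W', hcov, fun B hB hWB => le_trans ?_ hMW'⟩
      rcases hMT with rfl | ⟨B', hB', -, rfl⟩
      · by_contra h
        exact hM (W ⊓ B) (Set.mem_insert_of_mem _ ⟨B, hB, hWB, rfl⟩)
          (bot_lt_iff_ne_bot.2 fun h0 => h h0.le)
      · rcases hℬ.total hB hB' with h | h
        · exact inf_le_inf_left _ h
        · by_contra h'
          exact hM (W ⊓ B) (Set.mem_insert_of_mem _ ⟨B, hB, hWB, rfl⟩)
            (lt_of_le_not_ge (inf_le_inf_left _ h) h')
    -- Taking `z` in the smallest member of `𝒜` that meets `W` outside `W'` puts it in all the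
    -- larger ones. Inserting `⊤` makes the minimum exist.
    obtain ⟨z, hzW, hzW', hz𝒜⟩ : ∃ z ∈ W, z ∉ W' ∧ ∀ A ∈ 𝒜, ¬ W ⊓ A ≤ W' → z ∈ A := by
      have hc : IsChain (· ≤ ·) (insert ⊤ 𝒜) := h𝒜.insert fun _ _ _ => Or.inr le_top
      obtain ⟨A₀, ⟨hA₀, hA₀'⟩, hmin⟩ := wellFounded_lt.has_min
        {A | A ∈ insert ⊤ 𝒜 ∧ ¬ W ⊓ A ≤ W'}
        ⟨⊤, Set.mem_insert _ _, by simpa using hcov.lt.not_ge⟩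
      obtain ⟨z, hz, hz'⟩ := SetLike.not_le_iff_exists.1 hA₀'
      refine ⟨z, hz.1, hz', fun A hA hAW => ?_⟩
      rcases hc.total hA₀ (Set.mem_insert_of_mem _ hA) with h | h
      · exact h hz.2
      · by_contra hzA
        exact hmin A ⟨Set.mem_insert_of_mem _ hA, hAW⟩
          (lt_of_le_not_ge h fun h' => hzA (h' hz.2))
    obtain ⟨s, hs, hspan, hs𝒜, hsℬ⟩ := ih W' hcov.lt
    have hsup : W' ⊔ span 𝕜 {z} = W := by
      refine (hcov.wcovBy.eq_or_eq le_sup_left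
        (sup_le hcov.le ((span_singleton_le_iff_mem _ _).2 hzW))).resolve_left fun h => hzW' ?_
      rw [← h]
      exact (le_sup_right : span 𝕜 {z} ≤ _) (mem_span_singleton_self z)
    have hsW : insert z s ⊆ (W : Set V) := Set.insert_subset hzW
      (subset_span.trans (hspan.le.trans hcov.le))
    have key : ∀ A : Submodule 𝕜 V, span 𝕜 (s ∩ A) = W' ⊓ A → (z ∈ A ∨ W ⊓ A ≤ W') →
        span 𝕜 (insert z s ∩ A) = W ⊓ A := by
      intro A hA hzA
      have hmono : span 𝕜 (s ∩ A) ≤ span 𝕜 (insert z s ∩ A) :=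
        span_mono (Set.inter_subset_inter_left _ (Set.subset_insert _ _))
      refine le_antisymm (span_le.2 fun x hx => ⟨hsW hx.1, hx.2⟩) ?_
      rcases hzA with hzA | hWA
      · rintro x ⟨hxW, hxA⟩
        rw [SetLike.mem_coe, ← hsup] at hxW
        obtain ⟨w, hw, y, hy, rfl⟩ := mem_sup.1 hxW
        obtain ⟨c, rfl⟩ := mem_span_singleton.1 hy
        have hcz : c • z ∈ A := A.smul_mem c hzA
        have hwA : w ∈ A := by simpa using A.sub_mem hxA hcz
        refine add_mem (hmono (hA.ge ⟨hw, hwA⟩)) (smul_mem _ _ (subset_span ?_))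
        exact ⟨Set.mem_insert _ _, hzA⟩
      · exact (le_inf hWA inf_le_right).trans (hA.ge.trans hmono)
    refine ⟨insert z s, ?_, ?_, fun A hA => key A (hs𝒜 A hA) ?_, fun B hB => key B (hsℬ B hB) ?_⟩
    · refine hs.id_insert ?_
      rwa [hspan]
    · rw [span_insert, hspan, sup_comm, hsup]
    · by_cases h : W ⊓ A ≤ W'
      · exact Or.inr h
      · exact Or.inl (hz𝒜 A hA h)
    · by_cases h : W ≤ B
      · exact Or.inl (h hzW)
      · exact Or.inr (hW' B hB h)

open Submodule in
theorem exists_basis_span_image_eq {𝕜 : Type*} {V : Type*} [Field 𝕜] [AddCommGroup V]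
    [Module 𝕜 V] [FiniteDimensional 𝕜 V] {𝒜 ℬ : Set (Submodule 𝕜 V)}
    (h𝒜 : IsChain (· ≤ ·) 𝒜) (hℬ : IsChain (· ≤ ·) ℬ) :
    ∃ (n : ℕ) (b : Module.Basis (Fin n) 𝕜 V),
      (∀ A ∈ 𝒜, span 𝕜 (b '' {i | b i ∈ A}) = A) ∧
        ∀ B ∈ ℬ, span 𝕜 (b '' {i | b i ∈ B}) = B := by
  obtain ⟨s, hs, hspan, hs𝒜, hsℬ⟩ := exists_linearIndepOn_span_inter_eq h𝒜 hℬ ⊤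
  let b₀ : Module.Basis s 𝕜 V := Module.Basis.mk hs (by simp [hspan])
  have : Finite s := Module.Finite.finite_basis b₀
  obtain ⟨n, ⟨e⟩⟩ := Finite.exists_equiv_fin s
  have hb : ∀ A : Submodule 𝕜 V, b₀.reindex e '' {i | b₀.reindex e i ∈ A} = s ∩ A := by
    intro A
    ext x
    constructor
    · rintro ⟨i, hi, rfl⟩
      refine ⟨?_, hi⟩
      simp [b₀]
    · rintro ⟨hx, hxA⟩
      exact ⟨e ⟨x, hx⟩, by simpa [b₀] using hxA, by simp [b₀]⟩
  refine ⟨n, b₀.reindex e, fun A hA => ?_, fun B hB => ?_⟩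
  · rw [hb, hs𝒜 A hA, top_inf_eq]
  · rw [hb, hsℬ B hB, top_inf_eq]

/-! ### Persistence diagrams from adapted bases -/

/-- The finite diagram listing the values of a family of points. -/
def familyDiagram {κ : Type*} [Finite κ] (P : κ → Bar) : Diagram :=
  ((Set.finite_univ (α := κ)).toFinset.val).map P

theorem mem_familyDiagram {κ : Type*} [Finite κ] {P : κ → Bar} {Q : Bar} :
    Q ∈ familyDiagram P ↔ ∃ i, P i = Q := by
  simp [familyDiagram]

/-- Occurrences in the multiset correspond to indices of the family, so equal bars with different
indices stay distinct. This allows all matching arguments to run over indices. -/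
theorem exists_equiv_familyDiagram {κ : Type*} [Finite κ] (P : κ → Bar) :
    ∃ e : κ ≃ (familyDiagram P).ToType, ∀ i, ((e i : Bar)) = P i := by
  classical
  have : Fintype κ := Fintype.ofFinite κ
  let s : Multiset κ := (Set.finite_univ (α := κ)).toFinset.val
  have hs : s.Nodup := Finset.nodup _
  let f : s.ToType → κ := fun x => x
  have hf : Function.Bijective f := by
    refine (Fintype.bijective_iff_surjective_and_card f).2 ⟨fun i => ?_, ?_⟩
    · have hi : i ∈ s := by simp [s]
      exact ⟨s.mkToType i ⟨0, Multiset.count_pos.2 hi⟩, rfl⟩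
    · rw [Multiset.card_coe]
      simp [s]
  refine ⟨(Equiv.ofBijective f hf).symm.trans (s.mapEquiv P), fun i => ?_⟩
  have := Multiset.mapEquiv_apply s P ((Equiv.ofBijective f hf).symm i)
  refine this.trans (congrArg P ?_)
  exact (Equiv.ofBijective f hf).apply_symm_apply i

theorem intervalSum_map_apply (𝕜 : Type u) [Field 𝕜] {D : Diagram} {a b : ℝ} (h : a ≤ b)
    (f : (intervalSum 𝕜 D).V a) (α : {α : D.ToType // Bar.Alive (α : Bar) b})
    (hα : Bar.Alive (α.1 : Bar) a) :
    ((intervalSum 𝕜 D).map h f : _ → 𝕜) α = (f : _ → 𝕜) ⟨α.1, hα⟩ :=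
  dif_pos hα

theorem intervalSum_map_apply_of_not_alive (𝕜 : Type u) [Field 𝕜] {D : Diagram} {a b : ℝ}
    (h : a ≤ b) (f : (intervalSum 𝕜 D).V a) (α : {α : D.ToType // Bar.Alive (α : Bar) b})
    (hα : ¬ Bar.Alive (α.1 : Bar) a) :
    ((intervalSum 𝕜 D).map h f : _ → 𝕜) α = 0 :=
  dif_neg hα

namespace Filtration

/-- A basis adapted to the cycles and the boundaries of all sublevel complexes computes the
persistence diagram. -/
theorem isPersistenceDiagram_of_basis {X : Type v} (𝕜 : Type u) [Field 𝕜] (F : Filtration X)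
    (k : ℕ) {ι : Type*} (b : Module.Basis ι 𝕜 (Tuples 𝕜 X k))
    (hZ : ∀ ε, Submodule.span 𝕜 (b '' {i | b i ∈ cycles 𝕜 (F.sublevel ε) k}) =
      cycles 𝕜 (F.sublevel ε) k)
    (hB : ∀ ε, Submodule.span 𝕜 (b '' {i | b i ∈ boundaries 𝕜 (F.sublevel ε) k}) =
      boundaries 𝕜 (F.sublevel ε) k)
    {κ : Type*} [Finite κ] (P : κ → Bar) (hP : ∀ q, ((P q).1 : WithTop ℝ) < (P q).2)
    (j : κ → ι) (hj : Function.Injective j)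
    (halive : ∀ q ε, Bar.Alive (P q) ε ↔
      b (j q) ∈ cycles 𝕜 (F.sublevel ε) k ∧ b (j q) ∉ boundaries 𝕜 (F.sublevel ε) k)
    (hcov : ∀ i ε, b i ∈ cycles 𝕜 (F.sublevel ε) k → b i ∉ boundaries 𝕜 (F.sublevel ε) k →
      i ∈ Set.range j) :
    F.IsPersistenceDiagram 𝕜 k (familyDiagram P) := by
  classical
  refine ⟨fun Q hQ => ?_, ?_⟩
  · obtain ⟨q, rfl⟩ := mem_familyDiagram.1 hQ
    exact hP q
  obtain ⟨e, he⟩ := exists_equiv_familyDiagram P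
  have he' : ∀ α : (familyDiagram P).ToType, (α : Bar) = P (e.symm α) := fun α => by
    rw [← he, e.apply_symm_apply]
  have hmemZ : ∀ ε x, x ∈ cycles 𝕜 (F.sublevel ε) k ↔
      ∀ i, b.repr x i ≠ 0 → b i ∈ cycles 𝕜 (F.sublevel ε) k := by
    intro ε x
    conv_lhs => rw [← hZ ε, b.mem_span_image]
    simp [Set.subset_def]
  have hmemB : ∀ ε x, x ∈ boundaries 𝕜 (F.sublevel ε) k ↔
      ∀ i, b.repr x i ≠ 0 → b i ∈ boundaries 𝕜 (F.sublevel ε) k := by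
    intro ε x
    conv_lhs => rw [← hB ε, b.mem_span_image]
    simp [Set.subset_def]
  -- Send a cycle to its coordinates along the basis vectors alive at `ε`. The remaining basis
  -- vectors in its support are boundaries, so the kernel is exactly the boundaries.
  let f : ∀ ε : ℝ, cycles 𝕜 (F.sublevel ε) k →ₗ[𝕜] (intervalSum 𝕜 (familyDiagram P)).V ε :=
    fun ε => (LinearMap.pi fun α : {α : (familyDiagram P).ToType // Bar.Alive (α : Bar) ε} =>
      b.coord (j (e.symm α.1))) ∘ₗ (cycles 𝕜 (F.sublevel ε) k).subtype
  have hf : ∀ ε z α, (f ε z : _ → 𝕜) α = b.repr z (j (e.symm α.1)) := fun ε z α => rfl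
  have hsurj : ∀ ε, Function.Surjective (f ε) := by
    intro ε g
    have : Finite {α : (familyDiagram P).ToType // Bar.Alive (α : Bar) ε} := inferInstance
    let _ := Fintype.ofFinite {α : (familyDiagram P).ToType // Bar.Alive (α : Bar) ε}
    let g' : {α : (familyDiagram P).ToType // Bar.Alive (α : Bar) ε} → 𝕜 := g
    refine ⟨⟨∑ α, g' α • b (j (e.symm α.1)), Submodule.sum_mem _ fun α _ =>
      Submodule.smul_mem _ _ ?_⟩, ?_⟩
    · refine ((halive _ ε).1 ?_).1
      rw [← he']
      exact α.2
    · funext β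
      rw [hf]
      simp only [map_sum, map_smul, Module.Basis.repr_self, Finsupp.coe_finsetSum,
        Finset.sum_apply, Finsupp.smul_apply, smul_eq_mul]
      rw [Finset.sum_eq_single β]
      · simp [g']
      · intro α _ hαβ
        rw [Finsupp.single_eq_of_ne, mul_zero]
        intro h
        exact hαβ (Subtype.ext (e.symm.injective (hj h.symm)))
      · simp
  have hker : ∀ ε, (boundaries 𝕜 (F.sublevel ε) k).submoduleOf (cycles 𝕜 (F.sublevel ε) k) =
      LinearMap.ker (f ε) := by
    intro ε
    ext ⟨z, hz⟩
    rw [Submodule.submoduleOf, Submodule.mem_comap, LinearMap.mem_ker, Submodule.subtype_apply,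
      hmemB]
    constructor
    · intro h
      funext α
      rw [hf]
      by_contra h0
      refine ((halive _ ε).1 ?_).2 (h _ h0)
      rw [← he']
      exact α.2
    · intro h i hi
      by_contra hiB
      have hiZ := (hmemZ ε z).1 hz i hi
      obtain ⟨q, rfl⟩ := hcov i ε hiZ hiB
      have hq : Bar.Alive (e q : Bar) ε := by
        rw [he]
        exact (halive q ε).2 ⟨hiZ, hiB⟩
      have := congrFun h ⟨e q, hq⟩
      rw [hf] at this
      simp only [e.symm_apply_apply] at this
      exact hi this
  suffices hmain : ∀ (a c : ℝ) (h : a ≤ c) (z : cycles 𝕜 (F.sublevel a) k),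
      f c (Submodule.inclusion (cycles_mono 𝕜 (F.sublevel_mono h) k) z) =
        (intervalSum 𝕜 (familyDiagram P)).map h (f a z) from
    ⟨fun ε => (Submodule.quotEquivOfEq _ _ (hker ε)).trans
      ((f ε).quotKerEquivOfSurjective (hsurj ε)), fun a c h x =>
        Submodule.Quotient.induction_on _ x (hmain a c h)⟩
  intro a c h z
  funext α
  rw [hf]
  by_cases hα : Bar.Alive (α.1 : Bar) a
  · rw [intervalSum_map_apply 𝕜 h _ α hα, hf]
    rfl
  · rw [intervalSum_map_apply_of_not_alive 𝕜 h _ α hα]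
    -- A nonzero coordinate at a bar not alive at `a` belongs to a vector that is already a boundary
    -- at `a`, hence at `c`, contradicting that the bar is alive at `c`.
    by_contra h0
    have hZa := (hmemZ a z).1 z.2 _ h0
    have hBa : b (j (e.symm α.1)) ∈ boundaries 𝕜 (F.sublevel a) k := by
      by_contra hBa
      apply hα
      rw [he']
      exact (halive _ a).2 ⟨hZa, hBa⟩
    have hc : Bar.Alive (P (e.symm α.1)) c := by
      rw [← he']
      exact α.2
    exact ((halive _ c).1 hc).2 (boundaries_mono 𝕜 (F.sublevel_mono h) k hBa)

/-! ### Existence of persistence diagrams -/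

/-- Every sublevel set of `F` is a sublevel set of `H`. -/
def Coarser {X : Type v} (F H : Filtration X) : Prop :=
  ∀ s t, H.toFun s ≤ H.toFun t → F.toFun s ≤ F.toFun t

theorem Coarser.refl {X : Type v} (F : Filtration X) : F.Coarser F := fun _ _ h => h

/-- Among the finitely many sets with `F`-value at most `ε`, one of largest `H`-value gives the
level. If there are none, the complex is empty, as is that of `H` below its minimum `H.toFun ∅`. -/
theorem Coarser.sublevel_eq {X : Type v} [Finite X] {F H : Filtration X} (hF : F.Coarser H)
    (ε : ℝ) : (∃ s, F.toFun s ≤ ε ∧ F.sublevel ε = H.sublevel (H.toFun s)) ∨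
      ((∀ s, ε < F.toFun s) ∧ F.sublevel ε = H.sublevel (H.toFun ∅ - 1)) := by
  by_cases h : ∃ s, F.toFun s ≤ ε
  · obtain ⟨s, hs, hmax⟩ := Set.exists_max_image {s | F.toFun s ≤ ε} H.toFun
      (Set.toFinite _) h
    refine Or.inl ⟨s, hs, ?_⟩
    ext σ
    exact and_congr_right fun _ => ⟨fun h' => hmax _ h', fun h' => (hF _ _ h').trans hs⟩
  · push Not at h
    refine Or.inr ⟨h, ?_⟩
    ext σ
    refine and_congr_right fun _ => ⟨fun h' => absurd h' (h _).not_ge, fun h' => ?_⟩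
    have := H.mono (Set.empty_subset (σ : Set X))
    change H.toFun σ ≤ _ at h'
    change H.toFun ∅ ≤ H.toFun σ at this
    linarith

/-- The set `s` minimises `H` among the levels at which `z` is present. Since every sublevel complex
of a coarser `F` is one of `H`, the same `s` marks the entry of `z` for `F`. Nonvanishing of `z`
excludes parameters below all values of `F`, where the complex is empty. -/
theorem Coarser.exists_level {X : Type v} [Finite X] {M : Type*} [AddCommGroup M]
    {𝕜 : Type u} [Field 𝕜] [Module 𝕜 M] (H : Filtration X)
    {Φ : PreAbstractSimplicialComplex X → Submodule 𝕜 M} (hΦ : Monotone Φ)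
    (hΦ₀ : ∀ K, K.faces = ∅ → Φ K = ⊥) {z : M} (hz₀ : z ≠ 0)
    (hz : z ∈ Φ (H.sublevel (H.toFun Set.univ))) :
    ∃ s, ∀ F : Filtration X, F.Coarser H → ∀ ε, z ∈ Φ (F.sublevel ε) ↔ F.toFun s ≤ ε := by
  obtain ⟨s, hs, hmin⟩ := Set.exists_min_image {s | z ∈ Φ (H.sublevel (H.toFun s))} H.toFun
    (Set.toFinite _) ⟨Set.univ, hz⟩
  refine ⟨s, fun F hF ε => ⟨fun h => ?_, fun h => ?_⟩⟩
  · rcases hF.sublevel_eq ε with ⟨t, ht, heq⟩ | ⟨ht, -⟩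
    · rw [heq] at h
      exact (hF _ _ (hmin t h)).trans ht
    · rw [hΦ₀ _ (Set.eq_empty_of_forall_notMem
        fun (σ : Finset X) (hσ : σ ∈ (F.sublevel ε).faces) => (ht σ).not_ge hσ.2)] at h
      exact absurd h hz₀
  · have hle : H.sublevel (H.toFun s) ≤ F.sublevel ε :=
      fun σ hσ => ⟨hσ.1, (hF _ _ hσ.2).trans h⟩
    exact hΦ hle hs

theorem Coarser.sublevel_le {X : Type v} {F H : Filtration X} (ε : ℝ) :
    F.sublevel ε ≤ H.sublevel (H.toFun Set.univ) :=
  fun _ hσ => ⟨hσ.1, H.mono (Set.subset_univ _)⟩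

theorem chains_eq_bot {X : Type v} (𝕜 : Type u) [Field 𝕜] {K : PreAbstractSimplicialComplex X}
    (hK : K.faces = ∅) (n : ℕ) : chains 𝕜 K n = ⊥ := by
  have : {x : Fin (n + 1) → X | Spans K x} = ∅ :=
    Set.eq_empty_of_forall_notMem fun x hx => by
      have hx : _ ∈ K.faces := hx
      rw [hK] at hx
      exact hx
  rw [chains, this, Finsupp.supported_empty]

theorem cycles_eq_bot {X : Type v} (𝕜 : Type u) [Field 𝕜] {K : PreAbstractSimplicialComplex X}
    (hK : K.faces = ∅) (n : ℕ) : cycles 𝕜 K n = ⊥ := by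
  cases n with
  | zero => exact chains_eq_bot 𝕜 hK 0
  | succ n => rw [cycles, chains_eq_bot 𝕜 hK, bot_inf_eq]

theorem boundaries_eq_bot {X : Type v} (𝕜 : Type u) [Field 𝕜]
    {K : PreAbstractSimplicialComplex X} (hK : K.faces = ∅) (n : ℕ) : boundaries 𝕜 K n = ⊥ := by
  rw [boundaries, chains_eq_bot 𝕜 hK, Submodule.map_bot]

/-- The point spanned by the values of a filtration on a set and on a set or `⊤`. -/
def bar {X : Type v} (F : Filtration X) (p : Set X × WithTop (Set X)) : Bar :=
  (F.toFun p.1, p.2.map F.toFun)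

/-- The points of positive persistence among the values of `F` on a family of pairs. -/
def pairsDiagram {X : Type v} (F : Filtration X) {ι : Type*} [Finite ι]
    (p : ι → Set X × WithTop (Set X)) : Diagram :=
  familyDiagram fun i : {i // ((F.bar (p i)).1 : WithTop ℝ) < (F.bar (p i)).2} => F.bar (p i)

/-- A pairing of birth sets and death sets depending only on the preorder given by `H`. -/
theorem exists_pairing {X : Type v} [Finite X] (𝕜 : Type u) [Field 𝕜] (H : Filtration X)
    (k : ℕ) : ∃ (ι : Type) (_ : Finite ι) (p : ι → Set X × WithTop (Set X)),
      ∀ F : Filtration X, F.Coarser H → F.IsPersistenceDiagram 𝕜 k (F.pairsDiagram p) := by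
  classical
  have hchain : ∀ Φ : PreAbstractSimplicialComplex X → Submodule 𝕜 (Tuples 𝕜 X k), Monotone Φ →
      IsChain (· ≤ ·) (Set.range fun ε => Φ (H.sublevel ε)) := fun Φ hΦ =>
    Monotone.isChain_range fun ε δ h => hΦ (H.sublevel_mono h)
  have hcm : Monotone fun K : PreAbstractSimplicialComplex X => cycles 𝕜 K k :=
    fun _ _ h => cycles_mono 𝕜 h k
  have hbm : Monotone fun K : PreAbstractSimplicialComplex X => boundaries 𝕜 K k :=
    fun _ _ h => boundaries_mono 𝕜 h k
  obtain ⟨n, b, hA, hB⟩ := exists_basis_span_image_eq (hchain _ hcm) (hchain _ hbm)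
  set T := H.sublevel (H.toFun Set.univ) with hT
  choose σ hσ using fun i : {i // b i ∈ cycles 𝕜 T k} =>
    Coarser.exists_level H hcm (fun K hK => cycles_eq_bot 𝕜 hK k) (b.ne_zero i) i.2
  -- The value `⊤` records a vector that never becomes a boundary.
  have hτ : ∀ i, ∃ τ : WithTop (Set X), ∀ F : Filtration X, F.Coarser H → ∀ ε : ℝ,
      b i ∈ boundaries 𝕜 (F.sublevel ε) k ↔
        ¬ (ε : WithTop ℝ) < τ.map F.toFun := by
    intro i
    by_cases hi : b i ∈ boundaries 𝕜 T k
    · obtain ⟨s, hs⟩ := Coarser.exists_level H hbm (fun K hK => boundaries_eq_bot 𝕜 hK k)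
        (b.ne_zero i) hi
      refine ⟨(s : WithTop (Set X)), fun F hF ε => (hs F hF ε).trans ?_⟩
      rw [not_lt, WithTop.map_coe, WithTop.coe_le_coe]
    · refine ⟨⊤, fun F hF ε => iff_of_false (fun h => hi ?_) ?_⟩
      · exact boundaries_mono 𝕜 (Coarser.sublevel_le ε) k h
      · exact not_not.2 (WithTop.coe_lt_top ε)
  choose τ hτ using hτ
  refine ⟨{i // b i ∈ cycles 𝕜 T k}, inferInstance, fun i => (σ i, τ i), fun F hF => ?_⟩
  have hsub : ∀ ε, ∃ δ, F.sublevel ε = H.sublevel δ := fun ε => by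
    rcases hF.sublevel_eq ε with ⟨s, -, h⟩ | ⟨-, h⟩
    · exact ⟨_, h⟩
    · exact ⟨_, h⟩
  have halive : ∀ (i : {i // b i ∈ cycles 𝕜 T k}) (ε : ℝ), Bar.Alive (F.bar (σ i, τ i)) ε ↔
      b i ∈ cycles 𝕜 (F.sublevel ε) k ∧ b i ∉ boundaries 𝕜 (F.sublevel ε) k := by
    intro i ε
    rw [hσ i F hF, hτ i F hF, not_not]
    rfl
  refine isPersistenceDiagram_of_basis 𝕜 F k b (fun ε => ?_) (fun ε => ?_) _ (fun q => q.2)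
    (fun q => q.1.1) (fun q r h => Subtype.ext (Subtype.ext h)) (fun q ε => halive q.1 ε) ?_
  · obtain ⟨δ, h⟩ := hsub ε
    rw [h]
    exact hA _ ⟨δ, rfl⟩
  · obtain ⟨δ, h⟩ := hsub ε
    rw [h]
    exact hB _ ⟨δ, rfl⟩
  · intro i ε hi hi'
    let i' : {i // b i ∈ cycles 𝕜 T k} := ⟨i, cycles_mono 𝕜 (Coarser.sublevel_le ε) k hi⟩
    have := (halive i' ε).2 ⟨hi, hi'⟩
    exact ⟨⟨i', (WithTop.coe_le_coe.2 this.1).trans_lt this.2⟩, rfl⟩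

end Filtration

/-! ### Uniqueness of barcodes -/

theorem PersistenceSpace.Isomorphic.symm {𝕜 : Type u} [Field 𝕜] {M : PersistenceSpace.{u, v} 𝕜}
    {N : PersistenceSpace.{u, w} 𝕜} (h : M.Isomorphic N) : N.Isomorphic M := by
  obtain ⟨e, he⟩ := h
  refine ⟨fun a => (e a).symm, fun a b hab x => ?_⟩
  rw [LinearEquiv.symm_apply_eq, he, LinearEquiv.apply_symm_apply]

universe w'

theorem PersistenceSpace.Isomorphic.trans {𝕜 : Type u} [Field 𝕜]
    {M : PersistenceSpace.{u, v} 𝕜} {N : PersistenceSpace.{u, w} 𝕜}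
    {L : PersistenceSpace.{u, w'} 𝕜} (h : M.Isomorphic N) (h' : N.Isomorphic L) :
    M.Isomorphic L := by
  obtain ⟨e, he⟩ := h
  obtain ⟨f, hf⟩ := h'
  refine ⟨fun a => (e a).trans (f a), fun a b hab x => ?_⟩
  rw [LinearEquiv.trans_apply, LinearEquiv.trans_apply, he, hf]

theorem PersistenceSpace.Isomorphic.finrank_range_eq {𝕜 : Type u} [Field 𝕜]
    {M : PersistenceSpace.{u, v} 𝕜} {N : PersistenceSpace.{u, w} 𝕜} (h : M.Isomorphic N)
    {a b : ℝ} (hab : a ≤ b) :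
    Module.finrank 𝕜 (LinearMap.range (M.map hab)) =
      Module.finrank 𝕜 (LinearMap.range (N.map hab)) := by
  obtain ⟨e, he⟩ := h
  have h1 : (e b).toLinearMap ∘ₗ M.map hab = N.map hab ∘ₗ (e a).toLinearMap :=
    LinearMap.ext fun x => he a b hab x
  have h2 : (LinearMap.range (M.map hab)).map (e b).toLinearMap = LinearMap.range (N.map hab) := by
    rw [← LinearMap.range_comp, h1, LinearMap.range_comp_of_range_eq_top _ (e a).range]
  rw [← h2]
  exact ((e b).finrank_map_eq _).symm

open Classical in
theorem card_subtype_toType (D : Diagram) (p : Bar → Prop) :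
    Nat.card {α : D.ToType // p (α : Bar)} = D.countP p := by
  rw [Nat.card_eq_fintype_card, Fintype.card_subtype]
  conv_rhs => rw [← Multiset.map_univ_coe D]
  rw [Multiset.countP_map]
  rfl

-- The structure map factors as a projection onto the bars alive at both ends followed by an
-- extension by zero, so its rank is their number.
open Classical in
theorem finrank_range_intervalSum_map (𝕜 : Type u) [Field 𝕜] (D : Diagram) {a b : ℝ}
    (hab : a ≤ b) :
    Module.finrank 𝕜 (LinearMap.range ((intervalSum 𝕜 D).map hab)) =
      D.countP fun P => Bar.Alive P a ∧ Bar.Alive P b := by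
  let C := {α : D.ToType // Bar.Alive (α : Bar) a ∧ Bar.Alive (α : Bar) b}
  let R : (intervalSum 𝕜 D).V a →ₗ[𝕜] (C → 𝕜) :=
    { toFun := fun (f : {α : D.ToType // Bar.Alive (α : Bar) a} → 𝕜) γ => f ⟨γ.1, γ.2.1⟩
      map_add' := fun _ _ => rfl
      map_smul' := fun _ _ => rfl }
  let E : (C → 𝕜) →ₗ[𝕜] ({α : D.ToType // Bar.Alive (α : Bar) b} → 𝕜) :=
    { toFun := fun g α => if h : Bar.Alive (α.1 : Bar) a then g ⟨α.1, h, α.2⟩ else 0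
      map_add' := by
        intro f g
        funext α
        by_cases h : Bar.Alive (α.1 : Bar) a <;> simp [h]
      map_smul' := by
        intro r f
        funext α
        by_cases h : Bar.Alive (α.1 : Bar) a <;> simp [h] }
  have hR : Function.Surjective R := by
    intro g
    refine ⟨fun (α : {α : D.ToType // Bar.Alive (α : Bar) a}) =>
      if h : Bar.Alive (α.1 : Bar) b then g ⟨α.1, α.2, h⟩ else 0, ?_⟩
    funext γ
    exact dif_pos γ.2.2
  have hE : Function.Injective E := by
    intro f g hfg
    funext γ
    have := congrFun hfg ⟨γ.1, γ.2.2⟩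
    exact ((dif_pos γ.2.1).symm.trans this).trans (dif_pos γ.2.1)
  refine (show _ = Module.finrank 𝕜 (LinearMap.range (E ∘ₗ R)) from rfl).trans ?_
  rw [LinearMap.range_comp_of_range_eq_top _ (LinearMap.range_eq_top.2 hR),
    LinearMap.finrank_range_of_inj hE, Module.finrank_fintype_fun_eq_card,
    ← Nat.card_eq_fintype_card]
  convert card_subtype_toType D fun P => Bar.Alive P a ∧ Bar.Alive P b

theorem Diagram.exists_dominant {D : Diagram} (hD : D ≠ 0) :
    ∃ P ∈ D, ∀ Q ∈ D, P.1 ≤ Q.1 ∧ (Q.1 = P.1 → Q.2 ≤ P.2) := by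
  classical
  obtain ⟨P₀, hP₀⟩ := Multiset.exists_mem_of_ne_zero hD
  obtain ⟨P, hP, hmax⟩ := D.toFinset.exists_max_image
    (fun P : Bar => toLex (OrderDual.toDual P.1, P.2)) ⟨P₀, by simpa using hP₀⟩
  refine ⟨P, by simpa using hP, fun Q hQ => ?_⟩
  have := hmax Q (by simpa using hQ)
  rw [Prod.Lex.le_iff] at this
  rcases this with h | ⟨h, h'⟩
  · have h : P.1 < Q.1 := h
    exact ⟨h.le, fun h' => absurd h' h.ne'⟩
  · have h : Q.1 = P.1 := h
    exact ⟨h.ge, fun _ => h'⟩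

-- Peel off a bar of earliest birth and, among those, latest death. The counts force this bar to be
-- the same in both diagrams, and removing it preserves their equality.
open Classical in
theorem Diagram.eq_of_countP_eq {D D' : Diagram} (hD : ∀ P ∈ D, (P.1 : WithTop ℝ) < P.2)
    (hD' : ∀ P ∈ D', (P.1 : WithTop ℝ) < P.2)
    (h : ∀ a b : ℝ, a ≤ b → D.countP (fun P => Bar.Alive P a ∧ Bar.Alive P b) =
      D'.countP fun P => Bar.Alive P a ∧ Bar.Alive P b) : D = D' := by
  have transfer : ∀ {E E' : Diagram} {P : Bar} {a b : ℝ}, a ≤ b →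
      (E.countP (fun P => Bar.Alive P a ∧ Bar.Alive P b) =
        E'.countP fun P => Bar.Alive P a ∧ Bar.Alive P b) → P ∈ E → P.1 ≤ a →
      (b : WithTop ℝ) < P.2 → ∃ Q ∈ E', Q.1 ≤ a ∧ (b : WithTop ℝ) < Q.2 := by
    intro E E' P a b hab hEE' hP ha hb
    have : 0 < E.countP (fun P => Bar.Alive P a ∧ Bar.Alive P b) :=
      Multiset.countP_pos.2 ⟨P, hP, ⟨ha, (WithTop.coe_le_coe.2 hab).trans_lt hb⟩,
        ha.trans hab, hb⟩
    rw [hEE'] at this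
    obtain ⟨Q, hQ, hQa, hQb⟩ := Multiset.countP_pos.1 this
    exact ⟨Q, hQ, hQa.1, hQb.2⟩
  induction hn : Multiset.card D generalizing D D' with
  | zero =>
    obtain rfl := Multiset.card_eq_zero.1 hn
    refine (Multiset.eq_zero_of_forall_notMem fun P hP => ?_).symm
    obtain ⟨Q, hQ, -⟩ := transfer le_rfl (h P.1 P.1 le_rfl).symm hP le_rfl (hD' P hP)
    exact Multiset.notMem_zero _ hQ
  | succ n ih =>
    have h0 : D ≠ 0 := fun h0 => by simp [h0] at hn
    obtain ⟨P, hP, hPmax⟩ := Diagram.exists_dominant h0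
    have h0' : D' ≠ 0 := by
      rintro rfl
      obtain ⟨Q, hQ, -⟩ := transfer le_rfl (h P.1 P.1 le_rfl) hP le_rfl (hD P hP)
      exact Multiset.notMem_zero _ hQ
    obtain ⟨P', hP', hPmax'⟩ := Diagram.exists_dominant h0'
    have h1 : P.1 = P'.1 := by
      obtain ⟨Q, hQ, hQ', -⟩ := transfer le_rfl (h P.1 P.1 le_rfl) hP le_rfl (hD P hP)
      obtain ⟨R, hR, hR', -⟩ := transfer le_rfl (h P'.1 P'.1 le_rfl).symm hP' le_rfl (hD' P' hP')
      exact le_antisymm ((hPmax R hR).1.trans hR') ((hPmax' Q hQ).1.trans hQ')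
    have death : ∀ {E E' : Diagram} {P P' : Bar}, (∀ a b : ℝ, a ≤ b →
        E.countP (fun P => Bar.Alive P a ∧ Bar.Alive P b) =
          E'.countP fun P => Bar.Alive P a ∧ Bar.Alive P b) → P ∈ E → P.1 = P'.1 →
        (P'.1 : WithTop ℝ) < P'.2 → (∀ Q ∈ E', P'.1 ≤ Q.1 ∧ (Q.1 = P'.1 → Q.2 ≤ P'.2)) →
        P.2 ≤ P'.2 := by
      intro E E' P P' hEE' hP hPP' hlt hmax
      -- Otherwise count at the common birth and at `P'.2`: the bar `P` is alive at both, so `E'`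
      -- has a bar with that birth that outlives `P'`.
      by_contra! hd
      obtain ⟨b, hb⟩ := WithTop.ne_top_iff_exists.1 (hd.trans_le le_top).ne
      rw [← hb] at hd hlt
      obtain ⟨Q, hQ, hQ1, hQ2⟩ := transfer (WithTop.coe_le_coe.1 hlt.le)
        (hEE' _ _ (WithTop.coe_le_coe.1 hlt.le)) hP hPP'.le hd
      have := (hmax Q hQ).2 (le_antisymm hQ1 (hmax Q hQ).1)
      rw [← hb] at this
      exact absurd hQ2 this.not_gt
    have h2 : P = P' := Prod.ext h1 (le_antisymm (death h hP h1 (hD' P' hP') hPmax')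
      (death (fun a b hab => (h a b hab).symm) hP' h1.symm (hD P hP) hPmax))
    subst h2
    obtain ⟨E, rfl⟩ := Multiset.exists_cons_of_mem hP
    obtain ⟨E', rfl⟩ := Multiset.exists_cons_of_mem hP'
    congr 1
    refine ih (fun Q hQ => hD Q (Multiset.mem_cons_of_mem hQ))
      (fun Q hQ => hD' Q (Multiset.mem_cons_of_mem hQ)) (fun a b hab => ?_) (by simpa using hn)
    have := h a b hab
    rw [Multiset.countP_cons, Multiset.countP_cons] at this
    exact Nat.add_right_cancel this

theorem IsBarcode.unique {𝕜 : Type u} [Field 𝕜] {M : PersistenceSpace.{u, w} 𝕜} {D D' : Diagram}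
    (h : IsBarcode M D) (h' : IsBarcode M D') : D = D' :=
  Diagram.eq_of_countP_eq h.1 h'.1 fun a b hab => by
    rw [← finrank_range_intervalSum_map 𝕜 D hab, ← finrank_range_intervalSum_map 𝕜 D' hab]
    exact (h.2.symm.trans h'.2).finrank_range_eq hab

theorem IsBarcode.of_isomorphic {𝕜 : Type u} [Field 𝕜] {M : PersistenceSpace.{u, v} 𝕜}
    {N : PersistenceSpace.{u, w} 𝕜} {D : Diagram} (h : IsBarcode M D) (hMN : M.Isomorphic N) :
    IsBarcode N D :=
  ⟨h.1, hMN.symm.trans h.2⟩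

/-! ### Partial matchings -/

theorem deathDist_triangle (x y z : WithTop ℝ) :
    deathDist x z ≤ deathDist x y + deathDist y z := by
  induction x using WithTop.recTopCoe <;> induction y using WithTop.recTopCoe <;>
    induction z using WithTop.recTopCoe
  all_goals first
    | exact le_top.trans_eq (top_add _).symm
    | exact le_top.trans_eq (add_top _).symm
    | exact zero_le
    | exact edist_triangle _ _ _

theorem deathDist_comm (x y : WithTop ℝ) : deathDist x y = deathDist y x := by
  induction x using WithTop.recTopCoe <;> induction y using WithTop.recTopCoe
  all_goals first
    | rfl
    | exact edist_comm _ _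

theorem Bar.dist_comm (P Q : Bar) : Bar.dist P Q = Bar.dist Q P := by
  rw [Bar.dist, Bar.dist, edist_comm, deathDist_comm]

theorem Bar.dist_triangle (P Q R : Bar) : Bar.dist P R ≤ Bar.dist P Q + Bar.dist Q R :=
  max_le ((edist_triangle _ Q.1 _).trans (add_le_add (le_max_left _ _) (le_max_left _ _)))
    ((deathDist_triangle _ Q.2 _).trans (add_le_add (le_max_right _ _) (le_max_right _ _)))

/-- Half-persistence is 1-Lipschitz because each endpoint contributes at most half its displacement.
This bounds bars left unmatched when matchings are composed. -/
theorem Bar.halfPers_le (P Q : Bar) : Bar.halfPers P ≤ Bar.dist P Q + Bar.halfPers Q := by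
  obtain ⟨b, d⟩ := P
  obtain ⟨b', d'⟩ := Q
  induction d' using WithTop.recTopCoe with
  | top => exact le_top.trans_eq (add_top _).symm
  | coe d' =>
    induction d using WithTop.recTopCoe with
    | top =>
      refine le_top.trans_eq ((top_add (Bar.halfPers (b', (d' : WithTop ℝ)))).symm.trans ?_)
      congr 1
    | coe d =>
      change ENNReal.ofReal ((d - b) / 2) ≤
        max (edist b b') (edist d d') + ENNReal.ofReal ((d' - b') / 2)
      rw [edist_dist, edist_dist, ← ENNReal.ofReal_max]
      refine le_trans (ENNReal.ofReal_le_ofReal ?_) ENNReal.ofReal_add_le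
      have h1 := le_max_left (Dist.dist b b') (Dist.dist d d')
      have h2 := le_max_right (Dist.dist b b') (Dist.dist d d')
      have h3 := neg_abs_le (b - b')
      have h4 := le_abs_self (d - d')
      simp only [Real.dist_eq] at h1 h2 ⊢
      linarith

theorem Bar.halfPers_eq_zero {P : Bar} (h : ¬ (P.1 : WithTop ℝ) < P.2) : Bar.halfPers P = 0 := by
  obtain ⟨b, d⟩ := P
  induction d using WithTop.recTopCoe with
  | top => exact absurd (WithTop.coe_lt_top b) h
  | coe d =>
    have : d ≤ b := not_lt.1 fun h' => h (WithTop.coe_lt_coe.2 h')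
    exact ENNReal.ofReal_of_nonpos (by linarith)

/-- There is a partial matching of cost at most `c` between two families of points. -/
structure IsMatching {ι κ : Type*} (P : ι → Bar) (Q : κ → Bar) (c : ℝ≥0∞) (R : ι → κ → Prop) :
    Prop where
  right_unique : ∀ i j j', R i j → R i j' → j = j'
  left_unique : ∀ i i' j, R i j → R i' j → i = i'
  dist_le : ∀ i j, R i j → Bar.dist (P i) (Q j) ≤ c
  left_le : ∀ i, (¬ ∃ j, R i j) → Bar.halfPers (P i) ≤ c
  right_le : ∀ j, (¬ ∃ i, R i j) → Bar.halfPers (Q j) ≤ c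

theorem IsMatching.symm {ι κ : Type*} {P : ι → Bar} {Q : κ → Bar} {c : ℝ≥0∞}
    {R : ι → κ → Prop} (h : IsMatching P Q c R) : IsMatching Q P c fun j i => R i j where
  right_unique j i i' := h.left_unique i i' j
  left_unique j j' i := h.right_unique i j j'
  dist_le j i hij := (Bar.dist_comm _ _).trans_le (h.dist_le i j hij)
  left_le := h.right_le
  right_le := h.left_le

theorem IsMatching.comp_left_le {ι κ μ : Type*} {P : ι → Bar} {Q : κ → Bar} {S : μ → Bar}
    {c c' : ℝ≥0∞} {R : ι → κ → Prop} {R' : κ → μ → Prop} (h : IsMatching P Q c R)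
    (h' : IsMatching Q S c' R') (i : ι) (hi : ¬ ∃ m, ∃ j, R i j ∧ R' j m) :
    Bar.halfPers (P i) ≤ c + c' := by
  by_cases hj : ∃ j, R i j
  · obtain ⟨j, hj⟩ := hj
    exact (Bar.halfPers_le (P i) (Q j)).trans (add_le_add (h.dist_le i j hj)
      (h'.left_le j fun ⟨m, hm⟩ => hi ⟨m, j, hj, hm⟩))
  · exact (h.left_le i hj).trans le_self_add

theorem IsMatching.comp {ι κ μ : Type*} {P : ι → Bar} {Q : κ → Bar} {S : μ → Bar}
    {c c' : ℝ≥0∞} {R : ι → κ → Prop} {R' : κ → μ → Prop} (h : IsMatching P Q c R)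
    (h' : IsMatching Q S c' R') : IsMatching P S (c + c') fun i m => ∃ j, R i j ∧ R' j m where
  right_unique := by
    rintro i m m' ⟨j, hj, hm⟩ ⟨j', hj', hm'⟩
    obtain rfl := h.right_unique i j j' hj hj'
    exact h'.right_unique j m m' hm hm'
  left_unique := by
    rintro i i' m ⟨j, hj, hm⟩ ⟨j', hj', hm'⟩
    obtain rfl := h'.left_unique j j' m hm hm'
    exact h.left_unique i i' j hj hj'
  dist_le := by
    rintro i m ⟨j, hj, hm⟩
    exact (Bar.dist_triangle _ (Q j) _).trans (add_le_add (h.dist_le i j hj) (h'.dist_le j m hm))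
  left_le := h.comp_left_le h'
  right_le m hm := by
    rw [add_comm]
    exact h'.symm.comp_left_le h.symm m fun ⟨i, j, hj, hi⟩ => hm ⟨i, j, hi, hj⟩

/-- Two diagrams have a partial matching of cost at most `c`. -/
def Matched (D D' : Diagram) (c : ℝ≥0∞) : Prop :=
  ∃ R, IsMatching (fun α : D.ToType => (α : Bar)) (fun α : D'.ToType => (α : Bar)) c R

theorem Matched.symm {D D' : Diagram} {c : ℝ≥0∞} (h : Matched D D' c) : Matched D' D c :=
  let ⟨_, hR⟩ := h
  ⟨_, hR.symm⟩

theorem Matched.trans {D D' D'' : Diagram} {c c' : ℝ≥0∞} (h : Matched D D' c)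
    (h' : Matched D' D'' c') : Matched D D'' (c + c') :=
  let ⟨_, hR⟩ := h
  let ⟨_, hR'⟩ := h'
  ⟨_, hR.comp hR'⟩

theorem Matched.bottleneckDist_le {D D' : Diagram} {c : ℝ≥0∞} (h : Matched D D' c) :
    bottleneckDist D D' ≤ c := by
  obtain ⟨R, hR⟩ := h
  let B₁ : Set D.ToType := {i | ∃ j, R i j}
  let B₂ : Set D'.ToType := {j | ∃ i, R i j}
  choose f hf using fun i : B₁ => i.2
  let g : B₁ → B₂ := fun i => ⟨f i, i, hf i⟩
  have hg : Function.Bijective g := by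
    refine ⟨fun i i' h => ?_, fun ⟨j, i, hij⟩ => ⟨⟨i, j, hij⟩, ?_⟩⟩
    · have h : f i = f i' := congrArg Subtype.val h
      exact Subtype.ext (hR.left_unique _ _ _ (hf i) (h ▸ hf i'))
    · exact Subtype.ext (hR.right_unique _ _ _ (hf _) hij)
  refine iInf_le_of_le B₁ (iInf_le_of_le B₂ (iInf_le_of_le (Equiv.ofBijective g hg) ?_))
  exact max_le (iSup_le fun β => hR.dist_le _ _ (hf β))
    (max_le (iSup_le fun α => hR.left_le _ α.2) (iSup_le fun α => hR.right_le _ α.2))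

theorem IsMatching.matched {ι κ : Type*} [Finite ι] [Finite κ] {P : ι → Bar} {Q : κ → Bar}
    {c : ℝ≥0∞} {R : ι → κ → Prop} (h : IsMatching P Q c R) :
    Matched (familyDiagram P) (familyDiagram Q) c := by
  obtain ⟨e, he⟩ := exists_equiv_familyDiagram P
  obtain ⟨e', he'⟩ := exists_equiv_familyDiagram Q
  refine ⟨fun α β => R (e.symm α) (e'.symm β), ?_, ?_, ?_, ?_, ?_⟩
  · exact fun α β β' hβ hβ' => e'.symm.injective (h.right_unique _ _ _ hβ hβ')
  · exact fun α α' β hα hα' => e.symm.injective (h.left_unique _ _ _ hα hα')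
  · intro α β hαβ
    simpa only [← he, ← he', Equiv.apply_symm_apply] using h.dist_le _ _ hαβ
  · intro α hα
    have := h.left_le (e.symm α) fun ⟨j, hj⟩ => hα ⟨e' j, by simpa using hj⟩
    simpa only [← he, Equiv.apply_symm_apply] using this
  · intro β hβ
    have := h.right_le (e'.symm β) fun ⟨i, hi⟩ => hβ ⟨e i, by simpa using hi⟩
    simpa only [← he', Equiv.apply_symm_apply] using this

namespace Filtration

theorem dist_bar_le {X : Type v} {F G : Filtration X} {c : ℝ}
    (h : ∀ s, |F.toFun s - G.toFun s| ≤ c) (p : Set X × WithTop (Set X)) :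
    Bar.dist (F.bar p) (G.bar p) ≤ ENNReal.ofReal c := by
  have key : ∀ s, edist (F.toFun s) (G.toFun s) ≤ ENNReal.ofReal c := fun s => by
    rw [edist_dist, Real.dist_eq]
    exact ENNReal.ofReal_le_ofReal (h s)
  obtain ⟨s, t⟩ := p
  refine max_le (key s) ?_
  induction t using WithTop.recTopCoe with
  | top => exact zero_le
  | coe t => exact key t

/-- The points of positive persistence that a fixed pairing gives for two filtrations match. -/
theorem matched_pairsDiagram {X : Type v} {F G : Filtration X} {c : ℝ}
    (h : ∀ s, |F.toFun s - G.toFun s| ≤ c) {ι : Type*} [Finite ι]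
    (p : ι → Set X × WithTop (Set X)) :
    Matched (F.pairsDiagram p) (G.pairsDiagram p) (ENNReal.ofReal c) := by
  have half : ∀ {F G : Filtration X} (h : ∀ s, |F.toFun s - G.toFun s| ≤ c) (i : ι),
      ¬ ((G.bar (p i)).1 : WithTop ℝ) < (G.bar (p i)).2 →
        Bar.halfPers (F.bar (p i)) ≤ ENNReal.ofReal c := by
    intro F G h i hi
    refine (Bar.halfPers_le _ (G.bar (p i))).trans ?_
    rw [Bar.halfPers_eq_zero hi, add_zero]
    exact dist_bar_le h _
  refine IsMatching.matched (R := fun i j => i.1 = j.1) ⟨?_, ?_, ?_, ?_, ?_⟩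
  · exact fun i j j' hj hj' => Subtype.ext (hj.symm.trans hj')
  · exact fun i i' j hi hi' => Subtype.ext (hi.trans hi'.symm)
  · rintro ⟨i, hi⟩ ⟨j, hj⟩ hij
    obtain rfl : i = j := hij
    exact dist_bar_le h _
  · exact fun i hi => half h i.1 fun h' => hi ⟨⟨i.1, h'⟩, rfl⟩
  · refine fun j hj => half (fun s => ?_) j.1 fun h' => hj ⟨⟨j.1, h'⟩, rfl⟩
    rw [abs_sub_comm]
    exact h s

theorem IsPersistenceDiagram.existsUnique {X : Type v} [Finite X] (𝕜 : Type u) [Field 𝕜]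
    (F : Filtration X) (k : ℕ) : ∃! D, F.IsPersistenceDiagram 𝕜 k D := by
  obtain ⟨ι, _, p, hp⟩ := exists_pairing 𝕜 F k
  exact ⟨_, hp F (Coarser.refl F), fun D hD => IsBarcode.unique hD (hp F (Coarser.refl F))⟩

/-- The pairing built from the order of `G` computes both diagrams. -/
theorem Coarser.matched {X : Type v} [Finite X] {𝕜 : Type u} [Field 𝕜] {F G : Filtration X}
    (hFG : F.Coarser G) {c : ℝ} (h : ∀ s, |F.toFun s - G.toFun s| ≤ c) {k : ℕ} {D D' : Diagram}
    (hD : F.IsPersistenceDiagram 𝕜 k D) (hD' : G.IsPersistenceDiagram 𝕜 k D') :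
    Matched D D' (ENNReal.ofReal c) := by
  obtain ⟨ι, _, p, hp⟩ := exists_pairing 𝕜 G k
  rw [IsBarcode.unique hD (hp F hFG), IsBarcode.unique hD' (hp G (Coarser.refl G))]
  exact matched_pairsDiagram h p

/-! ### Linear interpolation of filtrations -/

/-- The convex combination `(1 - t) F + t G`. -/
def interpolate {X : Type v} (F G : Filtration X) (t : ℝ) (ht : t ∈ Set.Icc (0 : ℝ) 1) :
    Filtration X where
  toFun s := (1 - t) * F.toFun s + t * G.toFun s
  mono _ _ h := add_le_add (mul_le_mul_of_nonneg_left (F.mono h) (sub_nonneg.2 ht.2))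
    (mul_le_mul_of_nonneg_left (G.mono h) ht.1)

/-- Each strict inequality at `t` between values on two subsets persists near `t` by continuity, and
there are finitely many. Ties at `t` may break, so only this direction of coarseness holds. -/
theorem eventually_coarser_interpolate {X : Type v} [Finite X] (F G : Filtration X) (t : ℝ)
    (ht : t ∈ Set.Icc (0 : ℝ) 1) :
    ∀ᶠ s in nhds t, ∀ hs : s ∈ Set.Icc (0 : ℝ) 1,
      (F.interpolate G t ht).Coarser (F.interpolate G s hs) := by
  have key : ∀ᶠ s in nhds t, ∀ σ τ : Set X,
      (1 - t) * F.toFun σ + t * G.toFun σ < (1 - t) * F.toFun τ + t * G.toFun τ →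
      (1 - s) * F.toFun σ + s * G.toFun σ < (1 - s) * F.toFun τ + s * G.toFun τ := by
    refine Filter.eventually_all.2 fun σ => Filter.eventually_all.2 fun τ => ?_
    by_cases h : (1 - t) * F.toFun σ + t * G.toFun σ < (1 - t) * F.toFun τ + t * G.toFun τ
    · have h1 : Continuous fun s : ℝ => (1 - s) * F.toFun σ + s * G.toFun σ := by fun_prop
      have h2 : Continuous fun s : ℝ => (1 - s) * F.toFun τ + s * G.toFun τ := by fun_prop
      filter_upwards [h1.continuousAt.eventually_lt h2.continuousAt h] with s hs _ using hs
    · exact Filter.Eventually.of_forall fun s h' => absurd h' h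
  filter_upwards [key] with s hs _ σ τ h
  exact not_lt.1 fun h' => (hs τ σ h').not_ge h

end Filtration

/-- A transitive relation on `[0, 1]` that holds locally to both sides of every point relates the
endpoints. -/
theorem rel_zero_one_of_local {R : ℝ → ℝ → Prop}
    (htrans : ∀ r s t, 0 ≤ r → r ≤ s → s ≤ t → t ≤ 1 → R r s → R s t → R r t)
    (hleft : ∀ t, 0 ≤ t → t ≤ 1 → ∀ᶠ s in nhds t, 0 ≤ s → s ≤ t → R s t)
    (hright : ∀ t, 0 ≤ t → t ≤ 1 → ∀ᶠ s in nhds t, t ≤ s → s ≤ 1 → R t s) : R 0 1 := by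
  let S : Set ℝ := {t | 0 ≤ t ∧ t ≤ 1 ∧ R 0 t}
  have h00 : R 0 0 := (hleft 0 le_rfl zero_le_one).self_of_nhds le_rfl le_rfl
  have h0S : (0 : ℝ) ∈ S := ⟨le_rfl, zero_le_one, h00⟩
  have hbdd : BddAbove S := ⟨1, fun t ht => ht.2.1⟩
  set T := sSup S with hT
  have hT0 : 0 ≤ T := le_csSup hbdd h0S
  have hT1 : T ≤ 1 := csSup_le ⟨0, h0S⟩ fun t ht => ht.2.1
  -- The relation on the left of `T` shows that the supremum is attained; the one on its right would
  -- push past `T` if `T < 1`.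
  have hRT : R 0 T := by
    obtain ⟨δ, hδ, hball⟩ := Metric.eventually_nhds_iff.1 (hleft T hT0 hT1)
    obtain ⟨s, hs, hlt⟩ := exists_lt_of_lt_csSup ⟨0, h0S⟩ (sub_lt_self T hδ)
    have hsT : s ≤ T := le_csSup hbdd hs
    refine htrans 0 s T le_rfl hs.1 hsT hT1 hs.2.2 (hball ?_ hs.1 hsT)
    rw [Real.dist_eq, abs_lt]
    constructor <;> linarith
  rcases hT1.eq_or_lt with h | h
  · rwa [h] at hRT
  · obtain ⟨δ, hδ, hball⟩ := Metric.eventually_nhds_iff.1 (hright T hT0 hT1)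
    have hpos : 0 < min (δ / 2) (1 - T) := lt_min (by linarith) (by linarith)
    have h1 := min_le_left (δ / 2) (1 - T)
    have h2 := min_le_right (δ / 2) (1 - T)
    have hs : T + min (δ / 2) (1 - T) ∈ S := by
      refine ⟨by linarith, by linarith, htrans 0 T _ le_rfl hT0 (by linarith) (by linarith) hRT
        (hball ?_ (by linarith) (by linarith))⟩
      rw [Real.dist_eq, abs_lt]
      constructor <;> linarith
    have := le_csSup hbdd hs
    linarith

namespace Filtration

/-- Stability for two filtrations over the same finite set. -/
theorem matched_of_abs_sub_le {X : Type v} [Finite X] {𝕜 : Type u} [Field 𝕜] {F G : Filtration X}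
    {c : ℝ} (h : ∀ s, |F.toFun s - G.toFun s| ≤ c) {k : ℕ} {D D' : Diagram}
    (hD : F.IsPersistenceDiagram 𝕜 k D) (hD' : G.IsPersistenceDiagram 𝕜 k D') :
    Matched D D' (ENNReal.ofReal c) := by
  -- The cost `(t - s) * c` is additive in time, so composing matchings loses nothing.
  let R : ℝ → ℝ → Prop := fun s t => ∀ (hs : s ∈ Set.Icc (0 : ℝ) 1) (ht : t ∈ Set.Icc (0 : ℝ) 1)
    (E E' : Diagram), (F.interpolate G s hs).IsPersistenceDiagram 𝕜 k E →
      (F.interpolate G t ht).IsPersistenceDiagram 𝕜 k E' →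
        Matched E E' (ENNReal.ofReal ((t - s) * c))
  have hc : 0 ≤ c := (abs_nonneg _).trans (h ∅)
  have hdist : ∀ s t (hs : s ∈ Set.Icc (0 : ℝ) 1) (ht : t ∈ Set.Icc (0 : ℝ) 1) (σ : Set X),
      |(F.interpolate G s hs).toFun σ - (F.interpolate G t ht).toFun σ| ≤ |t - s| * c := by
    intro s t hs ht σ
    have : (F.interpolate G s hs).toFun σ - (F.interpolate G t ht).toFun σ =
        (t - s) * (F.toFun σ - G.toFun σ) := by
      simp only [interpolate]
      ring
    rw [this, abs_mul]
    exact mul_le_mul_of_nonneg_left (h σ) (abs_nonneg _)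
  have hR : R 0 1 := by
    refine rel_zero_one_of_local ?_ ?_ ?_
    · intro r s t hr hrs hst ht h1 h2 hr' ht' E E'' hE hE''
      have hs' : s ∈ Set.Icc (0 : ℝ) 1 := ⟨hr.trans hrs, hst.trans ht⟩
      obtain ⟨E', hE', -⟩ := IsPersistenceDiagram.existsUnique 𝕜 (F.interpolate G s hs') k
      have := (h1 hr' hs' E E' hE hE').trans (h2 hs' ht' E' E'' hE' hE'')
      rwa [← ENNReal.ofReal_add (mul_nonneg (sub_nonneg.2 hrs) hc)
        (mul_nonneg (sub_nonneg.2 hst) hc), ← add_mul, sub_add_sub_cancel'] at this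
    · intro t ht0 ht1
      filter_upwards [F.eventually_coarser_interpolate G t ⟨ht0, ht1⟩] with s hs _ hst hs' ht' E E'
        hE hE'
      -- The filtration at `t` is the coarser one on either side, so to the left of `t` the matching
      -- is obtained reversed.
      refine ((hs hs').matched (fun σ => ?_) hE' hE).symm
      refine (hdist t s ht' hs' σ).trans_eq ?_
      rw [abs_sub_comm, abs_of_nonneg (sub_nonneg.2 hst)]
    · intro t ht0 ht1
      filter_upwards [F.eventually_coarser_interpolate G t ⟨ht0, ht1⟩] with s hs hst _ ht' hs' E E'
        hE hE'
      refine (hs hs').matched (fun σ => ?_) hE hE'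
      refine (hdist t s ht' hs' σ).trans_eq ?_
      rw [abs_of_nonneg (sub_nonneg.2 hst)]
  have h0 : F.interpolate G 0 ⟨le_rfl, zero_le_one⟩ = F := by
    cases F
    simp [interpolate]
  have h1 : F.interpolate G 1 ⟨zero_le_one, le_rfl⟩ = G := by
    cases G
    simp [interpolate]
  have := hR ⟨le_rfl, zero_le_one⟩ ⟨zero_le_one, le_rfl⟩ D D' (by rwa [h0]) (by rwa [h1])
  rwa [sub_zero, one_mul] at this

end Filtration

/-! ### Pullbacks along surjections -/

section Prism

variable (𝕜 : Type u) [Field 𝕜] {X : Type v} {Y : Type w}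

/-- The map on tuples induced by a map of vertices. -/
def tuplesMap (g : X → Y) (n : ℕ) : Tuples 𝕜 X n →ₗ[𝕜] Tuples 𝕜 Y n :=
  Finsupp.lmapDomain 𝕜 𝕜 (g ∘ ·)

theorem tuplesMap_single (g : X → Y) (n : ℕ) (x : Fin (n + 1) → X) (c : 𝕜) :
    tuplesMap 𝕜 g n (Finsupp.single x c) = Finsupp.single (g ∘ x) c :=
  Finsupp.mapDomain_single

theorem tuplesMap_tuplesMap {Z : Type*} (f : X → Y) (g : Y → Z) (n : ℕ) (c : Tuples 𝕜 X n) :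
    tuplesMap 𝕜 g n (tuplesMap 𝕜 f n c) = tuplesMap 𝕜 (g ∘ f) n c :=
  Finsupp.mapDomain_comp.symm

theorem tuplesMap_id (n : ℕ) (c : Tuples 𝕜 X n) : tuplesMap 𝕜 id n c = c :=
  Finsupp.mapDomain_id

theorem boundary_single (n : ℕ) (x : Fin (n + 2) → X) :
    boundary 𝕜 X n (Finsupp.single x 1) =
      ∑ i : Fin (n + 2), Finsupp.single (x ∘ i.succAbove) ((-1 : 𝕜) ^ (i : ℕ)) := by
  rw [boundary, Finsupp.linearCombination_single, one_smul]

theorem boundary_tuplesMap (g : X → Y) (n : ℕ) (c : Tuples 𝕜 X (n + 1)) :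
    boundary 𝕜 Y n (tuplesMap 𝕜 g (n + 1) c) = tuplesMap 𝕜 g n (boundary 𝕜 X n c) := by
  have : boundary 𝕜 Y n ∘ₗ tuplesMap 𝕜 g (n + 1) = tuplesMap 𝕜 g n ∘ₗ boundary 𝕜 X n := by
    refine Finsupp.lhom_ext' fun x => LinearMap.ext_ring ?_
    simp only [LinearMap.comp_apply, Finsupp.lsingle_apply, tuplesMap_single, boundary_single,
      map_sum]
    rfl
  exact LinearMap.congr_fun this c

/-- Adding a vertex in front of every tuple. -/
def cone (a : X) (n : ℕ) : Tuples 𝕜 X n →ₗ[𝕜] Tuples 𝕜 X (n + 1) :=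
  Finsupp.lmapDomain 𝕜 𝕜 fun x => (Fin.cons a x : Fin (n + 2) → X)

theorem cone_single (a : X) (n : ℕ) (x : Fin (n + 1) → X) (c : 𝕜) :
    cone 𝕜 a n (Finsupp.single x c) = Finsupp.single (Fin.cons a x : Fin (n + 2) → X) c :=
  Finsupp.mapDomain_single

theorem cons_comp_succAbove_succ (a : X) {n : ℕ} (x : Fin (n + 2) → X) (i : Fin (n + 2)) :
    (Fin.cons a x : Fin (n + 3) → X) ∘ i.succ.succAbove = Fin.cons a (x ∘ i.succAbove) := by
  funext j
  refine Fin.cases ?_ (fun j => ?_) j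
  · simp
  · simp

/-- Deleting the apex returns the chain, and deleting any other vertex shifts its sign by one. In
degree zero the second term is instead the apex itself, since the complex is not augmented. -/
theorem boundary_cone_succ (a : X) (n : ℕ) (c : Tuples 𝕜 X (n + 1)) :
    boundary 𝕜 X (n + 1) (cone 𝕜 a (n + 1) c) = c - cone 𝕜 a n (boundary 𝕜 X n c) := by
  have : boundary 𝕜 X (n + 1) ∘ₗ cone 𝕜 a (n + 1) =
      LinearMap.id - cone 𝕜 a n ∘ₗ boundary 𝕜 X n := by
    refine Finsupp.lhom_ext' fun x => LinearMap.ext_ring ?_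
    simp only [LinearMap.comp_apply, LinearMap.sub_apply, LinearMap.id_apply,
      Finsupp.lsingle_apply, cone_single, boundary_single, map_sum]
    rw [Fin.sum_univ_succ, sub_eq_add_neg, ← Finset.sum_neg_distrib]
    congr 1
    · simp [Function.comp_def]
    · refine Finset.sum_congr rfl fun i _ => ?_
      rw [cons_comp_succAbove_succ, ← Finsupp.single_neg, Fin.val_succ, pow_succ, mul_neg_one]
  exact LinearMap.congr_fun this c

theorem boundary_cone_zero (a : X) (x : Fin 1 → X) :
    boundary 𝕜 X 0 (cone 𝕜 a 0 (Finsupp.single x 1)) =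
      Finsupp.single x 1 - Finsupp.single (fun _ => a) 1 := by
  rw [cone_single, boundary_single, Fin.sum_univ_two, sub_eq_add_neg, ← Finsupp.single_neg]
  congr 1
  · simp [Function.comp_def]
  · congr 1
    · funext j
      rw [Fin.fin_one_eq_zero j]
      rfl
    · simp

/-- The prism operator from the identity to `g`. -/
def prism (g : X → X) : (n : ℕ) → Tuples 𝕜 X n →ₗ[𝕜] Tuples 𝕜 X (n + 1)
  | 0 => Finsupp.linearCombination 𝕜 fun x =>
      cone 𝕜 (x 0) 0 (Finsupp.single (g ∘ x) 1)
  | n + 1 => Finsupp.linearCombination 𝕜 fun x =>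
      cone 𝕜 (x 0) (n + 1) (Finsupp.single (g ∘ x) 1) -
        cone 𝕜 (x 0) (n + 1) (prism g n (Finsupp.single (Fin.tail x) 1))

theorem prism_zero_single (g : X → X) (x : Fin 1 → X) :
    prism 𝕜 g 0 (Finsupp.single x 1) = cone 𝕜 (x 0) 0 (Finsupp.single (g ∘ x) 1) := by
  rw [prism, Finsupp.linearCombination_single, one_smul]

theorem prism_succ_single (g : X → X) (n : ℕ) (x : Fin (n + 2) → X) :
    prism 𝕜 g (n + 1) (Finsupp.single x 1) =
      cone 𝕜 (x 0) (n + 1) (Finsupp.single (g ∘ x) 1) -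
        cone 𝕜 (x 0) (n + 1) (prism 𝕜 g n (Finsupp.single (Fin.tail x) 1)) := by
  rw [prism, Finsupp.linearCombination_single, one_smul]

theorem prism_cone (g : X → X) (a : X) (n : ℕ) (c : Tuples 𝕜 X n) :
    prism 𝕜 g (n + 1) (cone 𝕜 a n c) =
      cone 𝕜 a (n + 1) (tuplesMap 𝕜 g (n + 1) (cone 𝕜 a n c)) -
        cone 𝕜 a (n + 1) (prism 𝕜 g n c) := by
  have : prism 𝕜 g (n + 1) ∘ₗ cone 𝕜 a n =
      cone 𝕜 a (n + 1) ∘ₗ tuplesMap 𝕜 g (n + 1) ∘ₗ cone 𝕜 a n -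
        cone 𝕜 a (n + 1) ∘ₗ prism 𝕜 g n := by
    refine Finsupp.lhom_ext' fun x => LinearMap.ext_ring ?_
    simp only [LinearMap.comp_apply, LinearMap.sub_apply, Finsupp.lsingle_apply]
    rw [cone_single, prism_succ_single, tuplesMap_single, Fin.cons_zero, Fin.tail_cons]
  exact LinearMap.congr_fun this c

theorem boundary_prism_zero (g : X → X) (c : Tuples 𝕜 X 0) :
    boundary 𝕜 X 0 (prism 𝕜 g 0 c) = tuplesMap 𝕜 g 0 c - c := by
  have : boundary 𝕜 X 0 ∘ₗ prism 𝕜 g 0 = tuplesMap 𝕜 g 0 - LinearMap.id := by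
    refine Finsupp.lhom_ext' fun x => LinearMap.ext_ring ?_
    simp only [LinearMap.comp_apply, LinearMap.sub_apply, Finsupp.lsingle_apply,
      LinearMap.id_apply]
    rw [prism_zero_single, boundary_cone_zero, tuplesMap_single]
    congr 3
    funext j
    rw [Subsingleton.elim j 0]
  exact LinearMap.congr_fun this c

/-- Every tuple is a cone `a·y`. Expanding with the cone formulas and the identity for `y` one
degree lower, all terms cancel but two. Degree one is separate because of the apex term in
`boundary_cone_zero`. -/
theorem boundary_prism_succ (g : X → X) (n : ℕ) (c : Tuples 𝕜 X (n + 1)) :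
    boundary 𝕜 X (n + 1) (prism 𝕜 g (n + 1) c) + prism 𝕜 g n (boundary 𝕜 X n c) =
      tuplesMap 𝕜 g (n + 1) c - c := by
  induction n with
  | zero =>
    have : boundary 𝕜 X 1 ∘ₗ prism 𝕜 g 1 + prism 𝕜 g 0 ∘ₗ boundary 𝕜 X 0 =
        tuplesMap 𝕜 g 1 - LinearMap.id := by
      refine Finsupp.lhom_ext' fun x => LinearMap.ext_ring ?_
      simp only [LinearMap.comp_apply, LinearMap.sub_apply, LinearMap.add_apply,
        Finsupp.lsingle_apply, LinearMap.id_apply]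
      obtain ⟨a, y, rfl⟩ : ∃ a y, x = Fin.cons a y := ⟨x 0, Fin.tail x, (Fin.cons_self_tail x).symm⟩
      rw [← cone_single, prism_cone, map_sub, boundary_cone_succ, boundary_cone_succ,
        boundary_prism_zero, boundary_tuplesMap, boundary_cone_zero, map_sub, map_sub, map_sub,
        map_sub, prism_zero_single 𝕜 g (fun _ => a), tuplesMap_single 𝕜 g 0 (fun _ => a)]
      abel
    exact LinearMap.congr_fun this c
  | succ n ih =>
    have : boundary 𝕜 X (n + 2) ∘ₗ prism 𝕜 g (n + 2) + prism 𝕜 g (n + 1) ∘ₗ boundary 𝕜 X (n + 1) =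
        tuplesMap 𝕜 g (n + 2) - LinearMap.id := by
      refine Finsupp.lhom_ext' fun x => LinearMap.ext_ring ?_
      simp only [LinearMap.comp_apply, LinearMap.sub_apply, LinearMap.add_apply,
        Finsupp.lsingle_apply, LinearMap.id_apply]
      obtain ⟨a, y, rfl⟩ : ∃ a y, x = Fin.cons a y := ⟨x 0, Fin.tail x, (Fin.cons_self_tail x).symm⟩
      have h := eq_sub_of_add_eq (ih (Finsupp.single y 1))
      rw [← cone_single, prism_cone, map_sub, boundary_cone_succ, boundary_cone_succ, h,
        boundary_tuplesMap, boundary_cone_succ, map_sub, map_sub, map_sub, map_sub, map_sub,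
        prism_cone]
      abel
    exact LinearMap.congr_fun this c

theorem cone_mem_supported {s : Set X} {a : X} (ha : a ∈ s) {n : ℕ} {c : Tuples 𝕜 X n}
    (hc : c ∈ Finsupp.supported 𝕜 𝕜 {x : Fin (n + 1) → X | Set.range x ⊆ s}) :
    cone 𝕜 a n c ∈ Finsupp.supported 𝕜 𝕜 {x : Fin (n + 2) → X | Set.range x ⊆ s} := by
  have h : cone 𝕜 a n c ∈ (Finsupp.supported 𝕜 𝕜 {x : Fin (n + 1) → X | Set.range x ⊆ s}).map
      (Finsupp.lmapDomain 𝕜 𝕜 fun x => (Fin.cons a x : Fin (n + 2) → X)) := ⟨c, hc, rfl⟩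
  rw [Finsupp.lmapDomain_supported] at h
  refine Finsupp.supported_mono ?_ h
  rintro _ ⟨x, hx, rfl⟩
  rw [Set.mem_ofPred_eq, Fin.range_cons]
  exact Set.insert_subset ha hx

theorem prism_single_mem_supported (g : X → X) {n : ℕ} {s : Set X} (x : Fin (n + 1) → X)
    (hx : Set.range x ⊆ s) (hgx : Set.range (g ∘ x) ⊆ s) :
    prism 𝕜 g n (Finsupp.single x 1) ∈
      Finsupp.supported 𝕜 𝕜 {y : Fin (n + 2) → X | Set.range y ⊆ s} := by
  induction n with
  | zero =>
    rw [prism_zero_single]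
    exact cone_mem_supported 𝕜 (hx ⟨0, rfl⟩) (Finsupp.single_mem_supported 𝕜 _ hgx)
  | succ n ih =>
    rw [prism_succ_single]
    refine Submodule.sub_mem _ (cone_mem_supported 𝕜 (hx ⟨0, rfl⟩)
      (Finsupp.single_mem_supported 𝕜 _ hgx)) (cone_mem_supported 𝕜 (hx ⟨0, rfl⟩) (ih _ ?_ ?_))
    · rintro _ ⟨i, rfl⟩
      exact hx ⟨i.succ, rfl⟩
    · rintro _ ⟨i, rfl⟩
      exact hgx ⟨i.succ, rfl⟩

/-- The prism over `x` involves only vertices of `x` and `g ∘ x`; the hypothesis is contiguity of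
`g` with the identity. -/
theorem prism_mem_chains {g : X → X} {K : PreAbstractSimplicialComplex X} {n : ℕ}
    (hg : ∀ (x : Fin (n + 1) → X) (y : Fin (n + 2) → X), Spans K x →
      Set.range y ⊆ Set.range x ∪ Set.range (g ∘ x) → Spans K y) {c : Tuples 𝕜 X n}
    (hc : c ∈ chains 𝕜 K n) : prism 𝕜 g n c ∈ chains 𝕜 K (n + 1) := by
  rw [chains, Finsupp.supported_eq_span_single] at hc
  induction hc using Submodule.span_induction with
  | mem c hc =>
    obtain ⟨x, hx, rfl⟩ := hc
    exact Finsupp.supported_mono (fun y hy => hg x y hx hy)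
      (prism_single_mem_supported 𝕜 g x Set.subset_union_left Set.subset_union_right)
  | zero => simp
  | add c d _ _ hc hd => rw [map_add]; exact add_mem hc hd
  | smul r c _ hc => rw [map_smul]; exact Submodule.smul_mem _ _ hc

/-- A map of vertices contiguous to the identity acts trivially on homology. -/
theorem tuplesMap_sub_mem_boundaries {g : X → X} {K : PreAbstractSimplicialComplex X} {n : ℕ}
    (hg : ∀ (x : Fin (n + 1) → X) (y : Fin (n + 2) → X), Spans K x →
      Set.range y ⊆ Set.range x ∪ Set.range (g ∘ x) → Spans K y) {c : Tuples 𝕜 X n}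
    (hc : c ∈ cycles 𝕜 K n) : tuplesMap 𝕜 g n c - c ∈ boundaries 𝕜 K n := by
  cases n with
  | zero => exact ⟨prism 𝕜 g 0 c, prism_mem_chains 𝕜 hg hc, boundary_prism_zero 𝕜 g c⟩
  | succ n =>
    refine ⟨prism 𝕜 g (n + 1) c, prism_mem_chains 𝕜 hg hc.1, ?_⟩
    rw [← boundary_prism_succ, LinearMap.mem_ker.1 hc.2, map_zero, add_zero]

theorem tuplesMap_mem_chains {g : X → Y} {K : PreAbstractSimplicialComplex X}
    {L : PreAbstractSimplicialComplex Y} {n : ℕ}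
    (hg : ∀ x : Fin (n + 1) → X, Spans K x → Spans L (g ∘ x)) {c : Tuples 𝕜 X n}
    (hc : c ∈ chains 𝕜 K n) : tuplesMap 𝕜 g n c ∈ chains 𝕜 L n := by
  have h : tuplesMap 𝕜 g n c ∈ (chains 𝕜 K n).map (Finsupp.lmapDomain 𝕜 𝕜 (g ∘ ·)) := ⟨c, hc, rfl⟩
  rw [chains, Finsupp.lmapDomain_supported] at h
  refine Finsupp.supported_mono ?_ h
  rintro _ ⟨x, hx, rfl⟩
  exact hg x hx

theorem tuplesMap_mem_cycles {g : X → Y} {K : PreAbstractSimplicialComplex X}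
    {L : PreAbstractSimplicialComplex Y} {n : ℕ}
    (hg : ∀ {m : ℕ} (x : Fin (m + 1) → X), Spans K x → Spans L (g ∘ x)) {c : Tuples 𝕜 X n}
    (hc : c ∈ cycles 𝕜 K n) : tuplesMap 𝕜 g n c ∈ cycles 𝕜 L n := by
  cases n with
  | zero => exact tuplesMap_mem_chains 𝕜 hg hc
  | succ n =>
    refine ⟨tuplesMap_mem_chains 𝕜 hg hc.1, LinearMap.mem_ker.2 ?_⟩
    rw [boundary_tuplesMap, LinearMap.mem_ker.1 hc.2, map_zero]

theorem tuplesMap_mem_boundaries {g : X → Y} {K : PreAbstractSimplicialComplex X}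
    {L : PreAbstractSimplicialComplex Y} {n : ℕ}
    (hg : ∀ {m : ℕ} (x : Fin (m + 1) → X), Spans K x → Spans L (g ∘ x)) {c : Tuples 𝕜 X n}
    (hc : c ∈ boundaries 𝕜 K n) : tuplesMap 𝕜 g n c ∈ boundaries 𝕜 L n := by
  obtain ⟨d, hd, rfl⟩ := hc
  exact ⟨tuplesMap 𝕜 g (n + 1) d, tuplesMap_mem_chains 𝕜 hg hd, boundary_tuplesMap 𝕜 g n d⟩

end Prism

namespace Filtration

theorem spans_sublevel {X : Type v} (F : Filtration X) (ε : ℝ) {n : ℕ} (x : Fin (n + 1) → X) :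
    Spans (F.sublevel ε) x ↔ F.toFun (Set.range x) ≤ ε := by
  refine (and_iff_right_of_imp fun _ => ?_).trans ?_
  · exact ⟨x 0, by simp⟩
  · rw [Set.Finite.coe_toFinset]

theorem spans_sublevel_pullback {X : Type v} {Z : Type w} (F : Filtration X) (φ : Z → X) (ε : ℝ)
    {n : ℕ} (x : Fin (n + 1) → Z) :
    Spans ((F.pullback φ).sublevel ε) x ↔ Spans (F.sublevel ε) (φ ∘ x) := by
  rw [spans_sublevel, spans_sublevel, Set.range_comp]
  rfl

/-- Pulling back along a surjection does not change persistent homology. -/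
theorem persistentHomology_pullback_isomorphic {X : Type v} {Z : Type w} (𝕜 : Type u) [Field 𝕜]
    (F : Filtration X) {φ : Z → X} (hφ : Function.Surjective φ) (k : ℕ) :
    ((F.pullback φ).persistentHomology 𝕜 k).Isomorphic (F.persistentHomology 𝕜 k) := by
  obtain ⟨s, hs⟩ := hφ.hasRightInverse
  have hφs : φ ∘ s = id := funext hs
  have hto : ∀ (ε : ℝ) {m : ℕ} (x : Fin (m + 1) → Z),
      Spans ((F.pullback φ).sublevel ε) x → Spans (F.sublevel ε) (φ ∘ x) :=
    fun ε m x => (F.spans_sublevel_pullback φ ε x).1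
  have hfrom : ∀ (ε : ℝ) {m : ℕ} (x : Fin (m + 1) → X),
      Spans (F.sublevel ε) x → Spans ((F.pullback φ).sublevel ε) (s ∘ x) := by
    intro ε m x hx
    rw [spans_sublevel_pullback, ← Function.comp_assoc, hφs]
    exact hx
  -- Adding the vertices `s (φ z)` to a simplex does not change its image under `φ`, hence not its
  -- filtration value, so `s ∘ φ` is contiguous to the identity.
  have hgs : ∀ (ε : ℝ) {n : ℕ} (x : Fin (n + 1) → Z) (y : Fin (n + 2) → Z),
      Spans ((F.pullback φ).sublevel ε) x →
        Set.range y ⊆ Set.range x ∪ Set.range ((s ∘ φ) ∘ x) →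
          Spans ((F.pullback φ).sublevel ε) y := by
    intro ε n x y hx hy
    rw [spans_sublevel] at hx ⊢
    refine (F.mono ?_ : F.toFun (φ '' Set.range y) ≤ F.toFun (φ '' Set.range x)).trans hx
    rintro _ ⟨z, hz, rfl⟩
    rcases hy hz with h | ⟨i, rfl⟩
    · exact ⟨z, h, rfl⟩
    · exact ⟨x i, ⟨i, rfl⟩, (hs _).symm⟩
  let f : ∀ ε, cycles 𝕜 ((F.pullback φ).sublevel ε) k →ₗ[𝕜] cycles 𝕜 (F.sublevel ε) k := fun ε =>
    (tuplesMap 𝕜 φ k).restrict fun c hc => tuplesMap_mem_cycles 𝕜 (hto ε) hc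
  let h : ∀ ε, Homology 𝕜 ((F.pullback φ).sublevel ε) k →ₗ[𝕜] Homology 𝕜 (F.sublevel ε) k :=
    fun ε => Submodule.mapQ _ _ (f ε) fun c hc => tuplesMap_mem_boundaries 𝕜 (hto ε) hc
  have hbij : ∀ ε, Function.Bijective (h ε) := by
    intro ε
    constructor
    · refine (injective_iff_map_eq_zero _).2 fun x => Submodule.Quotient.induction_on _ x ?_
      rintro ⟨c, hc⟩ h0
      have hf : f ε ⟨c, hc⟩ ∈ (boundaries 𝕜 (F.sublevel ε) k).submoduleOf
          (cycles 𝕜 (F.sublevel ε) k) := (Submodule.Quotient.mk_eq_zero _).1 h0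
      have hb : tuplesMap 𝕜 φ k c ∈ boundaries 𝕜 (F.sublevel ε) k := hf
      have hb' := tuplesMap_mem_boundaries 𝕜 (hfrom ε) hb
      rw [tuplesMap_tuplesMap] at hb'
      have := Submodule.sub_mem _ hb' (tuplesMap_sub_mem_boundaries 𝕜 (hgs ε) hc)
      rw [sub_sub_cancel] at this
      exact (Submodule.Quotient.mk_eq_zero _).2 this
    · intro x
      refine Submodule.Quotient.induction_on _ x ?_
      rintro ⟨c, hc⟩
      refine ⟨Submodule.Quotient.mk ⟨_, tuplesMap_mem_cycles 𝕜 (hfrom ε) hc⟩,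
        congrArg Submodule.Quotient.mk (Subtype.ext ?_)⟩
      change tuplesMap 𝕜 φ k (tuplesMap 𝕜 s k c) = c
      rw [tuplesMap_tuplesMap, hφs, tuplesMap_id]
  refine ⟨fun ε => LinearEquiv.ofBijective (h ε) (hbij ε), fun a b hab x => ?_⟩
  exact Submodule.Quotient.induction_on _ x fun _ => rfl

end Filtration

end FilteredSpaces

end

/-! ### Stability across different vertex sets -/

theorem FilteredSpaces.Filtration.bottleneckDist_le_supDist_pullback {𝕜 : Type*} [Field 𝕜]
    {X Y Z : Type*} [Finite Z] (FX : FilteredSpaces.Filtration X)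
    (FY : FilteredSpaces.Filtration Y) {φX : Z → X} (hX : Function.Surjective φX)
    {φY : Z → Y} (hY : Function.Surjective φY) {k : ℕ} {DX DY : FilteredSpaces.Diagram}
    (hDX : FX.IsPersistenceDiagram 𝕜 k DX) (hDY : FY.IsPersistenceDiagram 𝕜 k DY) :
    FilteredSpaces.bottleneckDist DX DY ≤
      FilteredSpaces.Filtration.supDist (FX.pullback φX) (FY.pullback φY) := by
  set c := FilteredSpaces.Filtration.supDist (FX.pullback φX) (FY.pullback φY) with hc
  by_cases hctop : c = ⊤
  · exact hctop ▸ le_top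
  -- The given diagrams are also those of the pullbacks, which live on the common finite set `Z`.
  have hX' : (FX.pullback φX).IsPersistenceDiagram 𝕜 k DX :=
    FilteredSpaces.IsBarcode.of_isomorphic hDX
      (FX.persistentHomology_pullback_isomorphic 𝕜 hX k).symm
  have hY' : (FY.pullback φY).IsPersistenceDiagram 𝕜 k DY :=
    FilteredSpaces.IsBarcode.of_isomorphic hDY
      (FY.persistentHomology_pullback_isomorphic 𝕜 hY k).symm
  have h := (FilteredSpaces.Filtration.matched_of_abs_sub_le (c := c.toReal) (fun s => ?_)
    hX' hY').bottleneckDist_le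
  · rwa [ENNReal.ofReal_toReal hctop] at h
  · rw [← Real.dist_eq, ← ENNReal.ofReal_le_iff_le_toReal hctop, ← edist_dist, hc]
    exact le_iSup (fun τ => edist ((FX.pullback φX).toFun τ) ((FY.pullback φY).toFun τ)) s

theorem theorem4p3 {𝕜 : Type*} [Field 𝕜] {X : Type*} [Finite X] {Y : Type*} [Finite Y]
    (FX : FilteredSpaces.Filtration X) (FY : FilteredSpaces.Filtration Y) (k : ℕ) :
    (∃! DX : FilteredSpaces.Diagram, FX.IsPersistenceDiagram 𝕜 k DX) ∧
    (∃! DY : FilteredSpaces.Diagram, FY.IsPersistenceDiagram 𝕜 k DY) ∧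
    ∀ DX DY : FilteredSpaces.Diagram,
      FX.IsPersistenceDiagram 𝕜 k DX → FY.IsPersistenceDiagram 𝕜 k DY →
        FilteredSpaces.bottleneckDist DX DY ≤ FX.filtDist FY := by
  refine ⟨FilteredSpaces.Filtration.IsPersistenceDiagram.existsUnique 𝕜 FX k,
    FilteredSpaces.Filtration.IsPersistenceDiagram.existsUnique 𝕜 FY k, fun DX DY hDX hDY => ?_⟩
  exact le_iInf fun Z => le_iInf fun _ => le_iInf fun φX => le_iInf fun hX => le_iInf fun φY =>
    le_iInf fun hY => FX.bottleneckDist_le_supDist_pullback FY hX hY hDX hDY
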